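/- For $h>0$ let $\Omega=\{p\in\mathbb{R}^3: -h<x_3<h\}$, let $P_\pm=\{x_3=\pm h\}$, and for $0<R_0<R_1$ let $A_{R_0,R_1}=\{z\in\mathbb{C}:R_0<|z|<R_1\}$. Let $\mathcal{A}(\Omega)$ be the set of proper conformal harmonic immersions $\mathbf F:A_{R_0,R_1}\to\Omega$ (for some $0<R_0<R_1$) whose image $\Sigma$ spans $P_+$ and $P_-$, that is, $\overline\Sigma\setminus\Sigma\subset P_+\cup P_-$ and $\overline\Sigma$ meets both planes. Write $\phi_j=\partial_xF_j-i\,\partial_yF_j$, and let $g=\phi_3/(\phi_1-i\phi_2)$ be the Gauss map of $\mathbf F$. For an integer $k$, $\mathcal{A}(\Omega,k)$ is the set of $\mathbf F\in\mathcal{A}(\Omega)$ whose Gauss map takes values in $\mathbb{C}\setminus\{0\}$ and has winding number $\pm k$ around $0$ along the circles $|z|=r$ (so $\mathcal{A}(\Omega,k)$ and $\mathcal{A}(\Omega,-k)$ are identified). $\mathcal{A}_V(\Omega,k)$ is the subset of those with vertical flux $\int_{|z|=r}\nu\,ds=(0,0,F_3)$, where $\nu$ is the unit conormal, and $\mathcal{A}^*(\Omega,2)$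 is the set of those $\mathbf F\in\mathcal{A}(\Omega,2)$ of the form $\mathbf F(z)=\mathbf G(z^2)$ with $\mathbf G\in\mathcal{A}(\Omega,1)$. Let $L(t)$ be the length (with multiplicity) of the curve $\theta\mapsto\mathbf F(e^{t+i\theta})$, $0\le\theta\le2\pi$, for $\log R_0<t<\log R_1$. **Theorem.** There are nonzero $c_1,c_2\in\mathbb{C}$ such that for every $h>0$ and every $\eta>0$ there are $\epsilon_1,\delta_1,\epsilon_2,\delta_2\in\mathbb{C}$ of modulus less than $\eta$, with $(\epsilon_1,\epsilon_2)\neq(0,0)$ and $\epsilon_j^2+2\delta_jc_j=0$ for $j=1,2$, and a map $\mathbf F:A_{R_0,R_1}\to\Omega$ with $$\mathbf F\in\mathcal{A}_V(\Omega,2)\setminus\mathcal{A}^*(\Omega,2),\qquad L\in C^2,\qquad L''(t)<4L(t)\ \text{ for all } t\in(\log R_0,\log R_1),$$ of the following form. There are $0<\rho_0<\rho_1$ and a map $\mathbf X:A_{\rho_0,\rho_1}\to\mathbb{R}^3$ with Weierstrass data $$g(z)=\frac{c_2z^{-1}+\epsilon_2+\delta_2z}{c_1z+\epsilon_1+\delta_1z^{-1}},\qquad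 f(z)=\frac{(c_1z+\epsilon_1+\delta_1z^{-1})^2}{z},$$ both holomorphic and without zeros on $A_{\rho_0,\rho_1}$, that is, $\partial_x\mathbf X-i\,\partial_y\mathbf X=\big(\tfrac12f(1-g^2),\tfrac i2f(1+g^2),fg\big)$; and $\mathbf F=\mathbf X\circ T$, where $T$ is an injective holomorphic map from $A_{R_0,R_1}$ onto $\{z\in A_{\rho_0,\rho_1}:\mathbf X(z)\in\Omega\}$, a set whose closure is contained in $A_{\rho_0,\rho_1}$. In particular, for every slab $\Omega$ there is a minimal annulus in $\mathcal{A}_V(\Omega,2)\setminus\mathcal{A}^*(\Omega,2)$ with $L''<4L$. -/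

import Mathlib

open scoped Real

namespace MinimalAnnuli

noncomputable section

/-- Euclidean three-space. -/
abbrev E3 : Type := EuclideanSpace ℝ (Fin 3)

/-- The open annulus `{z ∈ ℂ : R₀ < |z| < R₁}`. -/
def annulus (R₀ R₁ : ℝ) : Set ℂ := {z | R₀ < ‖z‖ ∧ ‖z‖ < R₁}

/-- The horizontal plane `{x₃ = h}`. -/
def plane (h : ℝ) : Set E3 := {p | p 2 = h}

/-- The open slab `{-h < x₃ < h}` between `plane (-h)` and `plane h`. -/
def slab (h : ℝ) : Set E3 := {p | -h < p 2 ∧ p 2 < h}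

/-- `φ_j = ∂F_j/∂x - i ∂F_j/∂y`, where `z = x + i y` (indices start at `0`). -/
def phi (F : ℂ → E3) (j : Fin 3) (z : ℂ) : ℂ :=
  ((fderiv ℝ F z 1 j : ℝ) : ℂ) - Complex.I * ((fderiv ℝ F z Complex.I j : ℝ) : ℂ)

/-- `F` maps the annulus into the slab as a proper conformal harmonic immersion (that is, a
proper conformal minimal immersion) and spans the two boundary planes. `ConformalAt` includes
that the differential is injective. -/
structure IsMinimalAnnulus (h R₀ R₁ : ℝ) (F : ℂ → E3) : Prop where
  inner_pos : 0 < R₀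
  inner_lt_outer : R₀ < R₁
  mapsTo : Set.MapsTo F (annulus R₀ R₁) (slab h)
  harmonic : InnerProductSpace.HarmonicOnNhd F (annulus R₀ R₁)
  conformal : ∀ z ∈ annulus R₀ R₁, ConformalAt F z
  proper : ∀ K : Set E3, K ⊆ slab h → IsCompact K → IsCompact (annulus R₀ R₁ ∩ F ⁻¹' K)
  boundary : closure (F '' annulus R₀ R₁) \ (F '' annulus R₀ R₁) ⊆ plane h ∪ plane (-h)
  spans_top : (closure (F '' annulus R₀ R₁) ∩ plane h).Nonempty
  spans_bottom : (closure (F '' annulus R₀ R₁) ∩ plane (-h)).Nonempty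

/-- The Gauss map after stereographic projection: in the Weierstrass representation
`φ₁ = f (1 - g²) / 2`, `φ₂ = i f (1 + g²) / 2`, `φ₃ = f g` one has
`f = φ₁ - i φ₂` and `g = φ₃ / f`. -/
def gaussMap (F : ℂ → E3) (z : ℂ) : ℂ := phi F 2 z / (phi F 0 z - Complex.I * phi F 1 z)

/-- The Gauss map takes values in `ℂ \ {0}` (it is finite because `f ≠ 0`, and nonzero because
`φ₃ ≠ 0`) and its winding number around `0` along each circle `|z| = r` is `k`. -/
def HasWindingNumber (R₀ R₁ : ℝ) (F : ℂ → E3) (k : ℤ) : Prop :=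
  (∀ z ∈ annulus R₀ R₁, phi F 2 z ≠ 0 ∧ phi F 0 z - Complex.I * phi F 1 z ≠ 0) ∧
  ∀ r ∈ Set.Ioo R₀ R₁,
    (∮ z in C(0, r), deriv (gaussMap F) z / gaussMap F z) = 2 * π * Complex.I * k

/-- The set `𝒜(Ω, k)`, with `𝒜(Ω, -k)` identified with `𝒜(Ω, k)`; `F` has domain
`annulus R₀ R₁` and `Ω = slab h`. -/
def MemA (h R₀ R₁ : ℝ) (k : ℤ) (F : ℂ → E3) : Prop :=
  IsMinimalAnnulus h R₀ R₁ F ∧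
    (HasWindingNumber R₀ R₁ F k ∨ HasWindingNumber R₀ R₁ F (-k))

/-- The velocity at angle `θ` of the parametrized circle `θ ↦ F (r e^{iθ})`. -/
def tangential (F : ℂ → E3) (r θ : ℝ) : E3 := deriv (fun s : ℝ => F (circleMap 0 r s)) θ

/-- The radial derivative `∂F/∂r` at `r e^{iθ}`. -/
def radial (F : ℂ → E3) (r θ : ℝ) : E3 := deriv (fun s : ℝ => F (circleMap 0 s θ)) r

/-- The flux `∫ ν ds` across the image of `|z| = r`. For a conformal immersion, the unit
conormal `ν` along that curve is the normalized radial derivative. -/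
def flux (F : ℂ → E3) (r : ℝ) : E3 :=
  ∫ θ in (0 : ℝ)..(2 * π), ‖tangential F r θ‖ • (‖radial F r θ‖⁻¹ • radial F r θ)

/-- The set `𝒜_V(Ω, k)`: elements of `𝒜(Ω, k)` with vertical flux `(0, 0, F₃)`. -/
def MemAV (h R₀ R₁ : ℝ) (k : ℤ) (F : ℂ → E3) : Prop :=
  MemA h R₀ R₁ k F ∧ ∀ r ∈ Set.Ioo R₀ R₁, flux F r 0 = 0 ∧ flux F r 1 = 0

/-- The set `𝒜*(Ω, k)`, for `k ≥ 1`: the elements `G ∘ (z ↦ z ^ k)` of `𝒜(Ω, k)` with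
`G ∈ 𝒜(Ω, 1)`. -/
def MemAStar (h R₀ R₁ : ℝ) (k : ℕ) (F : ℂ → E3) : Prop :=
  MemA h R₀ R₁ k F ∧
    ∃ G : ℂ → E3, MemA h (R₀ ^ k) (R₁ ^ k) 1 G ∧
      Set.EqOn F (fun z => G (z ^ k)) (annulus R₀ R₁)

/-- The length of the curve `F ({|z| = e^t})` (with multiplicity), as a function of
`t = log r`. -/
def levelLength (F : ℂ → E3) (t : ℝ) : ℝ :=
  ∫ θ in (0 : ℝ)..(2 * π), ‖tangential F (Real.exp t) θ‖

/-- `X` is given on `U` by the Weierstrass data `f`, `g`. -/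
def HasWeierstrassData (U : Set ℂ) (X : ℂ → E3) (f g : ℂ → ℂ) : Prop :=
  ∀ z ∈ U, DifferentiableAt ℝ X z ∧
    phi X 0 z = f z * (1 - g z ^ 2) / 2 ∧
    phi X 1 z = Complex.I * f z * (1 + g z ^ 2) / 2 ∧
    phi X 2 z = f z * g z

/-- `F`, on `annulus R₀ R₁`, is a conformal reparametrization `X ∘ T` of the part inside `slab h`
of a surface `X`, where `X` is given on a larger annulus by Weierstrass data `f`, `g`
such that `f`, `g` have no zeros there. -/
def IsSlabPiece (h R₀ R₁ : ℝ) (F : ℂ → E3) (f g : ℂ → ℂ) : Prop :=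
  ∃ (ρ₀ ρ₁ : ℝ) (X : ℂ → E3) (T : ℂ → ℂ), 0 < ρ₀ ∧ ρ₀ < ρ₁ ∧
    DifferentiableOn ℂ f (annulus ρ₀ ρ₁) ∧ DifferentiableOn ℂ g (annulus ρ₀ ρ₁) ∧
    (∀ z ∈ annulus ρ₀ ρ₁, f z ≠ 0 ∧ g z ≠ 0) ∧
    HasWeierstrassData (annulus ρ₀ ρ₁) X f g ∧
    DifferentiableOn ℂ T (annulus R₀ R₁) ∧ Set.InjOn T (annulus R₀ R₁) ∧
    T '' annulus R₀ R₁ = annulus ρ₀ ρ₁ ∩ X ⁻¹' slab h ∧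
    closure (T '' annulus R₀ R₁) ⊆ annulus ρ₀ ρ₁ ∧
    Set.EqOn F (X ∘ T) (annulus R₀ R₁)

end

end MinimalAnnuli

/-!
The example is a perturbation of the double cover of a catenoid in which only one end is disturbed:
`c₁ = c₂ = 1`, `ε₁ = δ₁ = 0`, `ε₂ = ε ≠ 0` and `δ₂ = -ε² / 2`. With
`psi = 1 + ε z - ε² z² / 2`, the Weierstrass data are `f = z` and `g = psi / z²`.

The relation between `δ₂` and `ε` says that `psi²` has no term in `z²`, so `φ₁` and `φ₂` have
single-valued primitives (`prim₁`, `prim₂`): the surface closes up and its flux is vertical. The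
form `φ₃ = psi / z dz` has residue `1`, so the height is `log |w|` up to a constant, where
`w = heightCoord z = z exp (ε z - ε² z² / 4)`. This is a local coordinate at `0`; with its inverse
`heightInv` as the reparametrization, the part of the surface in a slab is the image of a round
annulus `R₀ < |w| < R₁`.

In the coordinate `w` one has `φ₃ = dw / w`, so the length element on `|w| = r` is
`(|g| + 1 / |g|) / 2 dθ`. Here `g = (w² P²)⁻¹` with `P = gaussRoot` holomorphic near `0` and
`P(w) = 1 - (3 / 2) ε w + ⋯`. By Parseval's identity (`hasSum_integral_norm_sq_circleMap`)
`L = π (r⁻² A(r²) + r² B(r²))`, where `A(s) = ∑ |aₙ|² sⁿ` and `B(s) = ∑ |bₙ|² sⁿ` are formed from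
the Taylor coefficients of `1 / P` and `P`. With `s = r² = e^{2t}`,
`L'' - 4 L = 4 π (s A'' - A' + 3 s² B' + s³ B'')`,
which tends to `-4 π A'(0) = -9 π |ε|² < 0` as `s → 0` (`exists_deriv_deriv_lt_four_mul`). Hence
`L'' < 4 L` on every annulus with small enough outer radius `R₁` (`eventually_levelLength`). The
ratio `R₁ / R₀ = e^{2h}` is prescribed by the slab, but a vertical translation allows any value
of `R₁`, so every slab is covered.

Finally the surface is not a double cover: an element of `𝒜*` has an even Gauss map in the
coordinate `w`, while `P²` has the linear term `-3 ε w` (`IsGoodRadius.not_memAStar`).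
-/

namespace MinimalAnnuli

noncomputable section

open Metric Filter Topology

/-! ### Square means of holomorphic functions on circles -/

lemma hasSum_integral_of_norm_le {f : ℕ → ℝ → ℂ} {g : ℝ → ℂ} {b : ℕ → ℝ}
    (hf : ∀ n, Continuous (f n)) (hb : Summable b) (hfb : ∀ n θ, ‖f n θ‖ ≤ b n)
    (hs : ∀ θ, HasSum (fun n => f n θ) (g θ)) :
    HasSum (fun n => ∫ θ in (0 : ℝ)..(2 * π), f n θ) (∫ θ in (0 : ℝ)..(2 * π), g θ) :=
  intervalIntegral.hasSum_integral_of_dominated_convergence (fun n _ => b n)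
    (fun n => (hf n).aestronglyMeasurable)
    (fun n => Eventually.of_forall fun θ _ => hfb n θ)
    (Eventually.of_forall fun _ _ => hb) (by simp)
    (Eventually.of_forall fun θ _ => hs θ)

lemma norm_sq_eq_conj_mul (z : ℂ) : ((‖z‖ ^ 2 : ℝ) : ℂ) = starRingEnd ℂ z * z := by
  rw [mul_comm, Complex.mul_conj, Complex.normSq_eq_norm_sq]

lemma integral_conj_circleMap_pow_mul (r : ℝ) (m n : ℕ) :
    ∫ θ in (0 : ℝ)..(2 * π), starRingEnd ℂ (circleMap 0 r θ ^ n) * circleMap 0 r θ ^ m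
      = if m = n then 2 * π * (r : ℂ) ^ (2 * n) else 0 := by
  have key : ∀ θ : ℝ, starRingEnd ℂ (circleMap 0 r θ ^ n) * circleMap 0 r θ ^ m
      = (r : ℂ) ^ (n + m) * Complex.exp (((m - n) * Complex.I : ℂ) * θ) := by
    intro θ
    simp only [circleMap, zero_add, map_pow, map_mul, Complex.conj_ofReal, ← Complex.exp_conj,
      Complex.conj_I, mul_pow, map_natCast, ← Complex.exp_nat_mul]
    rw [show ((m - n) * Complex.I : ℂ) * θ = n * (θ * -Complex.I) + m * (θ * Complex.I) by ring,
      Complex.exp_add]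
    ring
  simp only [key, intervalIntegral.integral_const_mul]
  split_ifs with h
  · subst h
    simp
    ring
  · have hc : ((m - n) * Complex.I : ℂ) ≠ 0 :=
      mul_ne_zero (sub_ne_zero.2 (by exact_mod_cast h)) Complex.I_ne_zero
    rw [integral_exp_mul_complex hc]
    have : Complex.exp (((m - n) * Complex.I : ℂ) * (2 * π : ℝ)) = 1 :=
      Complex.exp_eq_one_iff.2 ⟨m - n, by push_cast; ring⟩
    rw [this]
    simp

/-- Parseval's identity for a power series on the circle `|w| = r`. -/
lemma hasSum_integral_norm_sq_circleMap {a : ℕ → ℂ} {P : ℂ → ℂ} {r : ℝ}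
    (ha : Summable fun n => ‖a n‖ * |r| ^ n)
    (hP : ∀ θ, HasSum (fun n => a n * circleMap 0 r θ ^ n) (P (circleMap 0 r θ))) :
    HasSum (fun n => 2 * π * (‖a n‖ ^ 2 * (r ^ 2) ^ n))
      (∫ θ in (0 : ℝ)..(2 * π), ‖P (circleMap 0 r θ)‖ ^ 2) := by
  have hcont : Continuous fun θ : ℝ => circleMap 0 r θ := continuous_circleMap 0 r
  have hnorm : ∀ n θ, ‖a n * circleMap 0 r θ ^ n‖ = ‖a n‖ * |r| ^ n := by
    intro n θ; simp
  have hPcont : Continuous fun θ => P (circleMap 0 r θ) := by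
    have : (fun θ => P (circleMap 0 r θ)) = fun θ => ∑' n, a n * circleMap 0 r θ ^ n :=
      funext fun θ => (hP θ).tsum_eq.symm
    rw [this]
    exact continuous_tsum (fun n => by fun_prop) ha fun n θ => (hnorm n θ).le
  have hPle : ∀ θ, ‖P (circleMap 0 r θ)‖ ≤ ∑' n, ‖a n‖ * |r| ^ n := by
    intro θ
    rw [← (hP θ).tsum_eq]
    exact tsum_of_norm_bounded ha.hasSum fun n => (hnorm n θ).le
  -- the Fourier coefficients of `P` on the circle
  have inner : ∀ n, ∫ θ in (0 : ℝ)..(2 * π),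
      starRingEnd ℂ (circleMap 0 r θ ^ n) * P (circleMap 0 r θ)
        = 2 * π * (r : ℂ) ^ (2 * n) * a n := by
    intro n
    have h1 := hasSum_integral_of_norm_le
      (f := fun m θ => starRingEnd ℂ (circleMap 0 r θ ^ n) * (a m * circleMap 0 r θ ^ m))
      (g := fun θ => starRingEnd ℂ (circleMap 0 r θ ^ n) * P (circleMap 0 r θ))
      (b := fun m => |r| ^ n * (‖a m‖ * |r| ^ m))
      (fun m => by fun_prop) (ha.mul_left _)
      (fun m θ => by simp) (fun θ => (hP θ).mul_left _)
    have h2 : ∀ m, ∫ θ in (0 : ℝ)..(2 * π),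
        starRingEnd ℂ (circleMap 0 r θ ^ n) * (a m * circleMap 0 r θ ^ m)
          = if m = n then 2 * π * (r : ℂ) ^ (2 * n) * a n else 0 := by
      intro m
      simp only [mul_left_comm _ (a m)]
      rw [intervalIntegral.integral_const_mul, integral_conj_circleMap_pow_mul]
      split_ifs with h
      · subst h; ring
      · simp
    simp only [h2] at h1
    exact h1.unique (hasSum_ite_eq n _)
  have h3 := hasSum_integral_of_norm_le
    (f := fun n θ => starRingEnd ℂ (a n * circleMap 0 r θ ^ n) * P (circleMap 0 r θ))
    (g := fun θ => starRingEnd ℂ (P (circleMap 0 r θ)) * P (circleMap 0 r θ))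
    (b := fun n => (‖a n‖ * |r| ^ n) * ∑' n, ‖a n‖ * |r| ^ n)
    (fun n => (Complex.continuous_conj.comp (by fun_prop)).mul hPcont) (ha.mul_right _)
    (fun n θ => by
      rw [norm_mul, RCLike.norm_conj, hnorm]
      gcongr
      exact hPle θ)
    (fun θ => ((hP θ).map (starRingEnd ℂ) Complex.continuous_conj).mul_right _)
  simp only [← norm_sq_eq_conj_mul, intervalIntegral.integral_ofReal] at h3
  rw [← Complex.hasSum_ofReal]
  convert! h3 using 2 with n
  simp only [map_mul, mul_assoc]
  rw [intervalIntegral.integral_const_mul, inner]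
  push_cast
  rw [show (‖a n‖ : ℂ) ^ 2 = starRingEnd ℂ (a n) * a n by
    rw [← norm_sq_eq_conj_mul]; push_cast; rfl]
  ring

/-- The mean of `|P|²` over the circle `|w| = r` is an analytic function of `r²` near `0`, with
Taylor coefficients the squared moduli of those of `P`. -/
theorem exists_analyticAt_integral_norm_sq {P : ℂ → ℂ} (hP : AnalyticAt ℂ P 0) :
    ∃ A : ℝ → ℝ, AnalyticAt ℝ A 0 ∧ deriv A 0 = ‖deriv P 0‖ ^ 2 ∧
      ∀ᶠ r in 𝓝 (0 : ℝ), ∫ θ in (0 : ℝ)..(2 * π), ‖P (circleMap 0 r θ)‖ ^ 2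
        = 2 * π * A (r ^ 2) := by
  obtain ⟨p, κ, hp⟩ := hP
  obtain ⟨ρ, hρ0, hρκ⟩ := ENNReal.lt_iff_exists_nnreal_btwn.1 hp.r_pos
  have hρ : (0 : ℝ) < ρ := by exact_mod_cast hρ0
  have hsum : ∀ r : ℝ, |r| ≤ ρ → Summable fun n => ‖p.coeff n‖ * |r| ^ n := by
    intro r hr
    have h1 := p.summable_norm_mul_pow (hρκ.trans_le hp.r_le)
    refine Summable.of_nonneg_of_le (fun n => by positivity) (fun n => ?_) h1
    rw [p.norm_apply_eq_norm_coef]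
    gcongr
  let q : FormalMultilinearSeries ℝ ℝ ℝ :=
    FormalMultilinearSeries.ofScalars ℝ fun n => ‖p.coeff n‖ ^ 2
  have hq : 0 < q.radius := by
    have h1 := hsum ρ (by simp)
    refine lt_of_lt_of_le (b := ((ρ * ρ : NNReal) : ENNReal))
      (by exact_mod_cast mul_pos hρ hρ)
      (q.le_radius_of_bound ((∑' n, ‖p.coeff n‖ * |(ρ : ℝ)| ^ n) ^ 2) fun n => ?_)
    have h2 : ‖q n‖ = ‖p.coeff n‖ ^ 2 := by
      rw [FormalMultilinearSeries.ofScalars_norm, Real.norm_of_nonneg (by positivity)]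
    calc ‖q n‖ * ((ρ * ρ : NNReal) : ℝ) ^ n = (‖p.coeff n‖ * |(ρ : ℝ)| ^ n) ^ 2 := by
          rw [h2, abs_of_pos hρ, NNReal.coe_mul]
          ring
      _ ≤ _ := by
          gcongr
          exact h1.le_tsum n fun _ _ => by positivity
  refine ⟨q.sum, (q.hasFPowerSeriesOnBall hq).analyticAt, ?_, ?_⟩
  · rw [(q.hasFPowerSeriesOnBall hq).hasFPowerSeriesAt.deriv, hp.hasFPowerSeriesAt.deriv]
    change q.coeff 1 = ‖p.coeff 1‖ ^ 2
    exact FormalMultilinearSeries.coeff_ofScalars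
  · filter_upwards [Metric.ball_mem_nhds (0 : ℝ) hρ] with r hr
    have hr' : |r| < ρ := by simpa using hr
    have hmem : ∀ θ, circleMap 0 r θ ∈ Metric.eball (0 : ℂ) κ := by
      intro θ
      have h6 : ‖circleMap 0 r θ‖₊ < ρ := by
        rw [← NNReal.coe_lt_coe, coe_nnnorm, norm_circleMap_zero]
        exact hr'
      rw [Metric.mem_eball, edist_zero_right]
      exact lt_trans (by exact_mod_cast h6) hρκ
    have h7 : ∀ θ, HasSum (fun n => p.coeff n * circleMap 0 r θ ^ n) (P (circleMap 0 r θ)) := by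
      intro θ
      have h8 := hp.hasSum (hmem θ)
      simpa only [FormalMultilinearSeries.apply_eq_pow_smul_coeff, zero_add, smul_eq_mul,
          mul_comm] using h8
    have h5 := hasSum_integral_norm_sq_circleMap (hsum r hr'.le) h7
    rw [← h5.tsum_eq, tsum_mul_left]
    congr 1
    exact (FormalMultilinearSeries.ofScalars_sum_eq (E := ℝ)
      (fun n => ‖p.coeff n‖ ^ 2) (r ^ 2)).symm

/-! ### The differential inequality for small radii -/

/-- The functions `e^{-2t}` and `e^{2t}` solve `ℓ'' = 4ℓ`, so only the variation of `A` and `B`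
counts; as `t → -∞`, the term `-4 c A'(0)` dominates `ℓ'' - 4ℓ`. -/
theorem exists_deriv_deriv_lt_four_mul {A B : ℝ → ℝ} (hA : AnalyticAt ℝ A 0)
    (hB : AnalyticAt ℝ B 0) (hA' : 0 < deriv A 0) (c : ℝ) (hc : 0 < c) :
    ∀ᶠ r in 𝓝[>] (0 : ℝ), ∀ ℓ : ℝ → ℝ,
      Set.EqOn ℓ (fun t => c * (Real.exp (-(2 * t)) * A (Real.exp (2 * t)) +
        Real.exp (2 * t) * B (Real.exp (2 * t)))) (Set.Iio (Real.log r)) →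
      ContDiffOn ℝ 2 ℓ (Set.Iio (Real.log r)) ∧
        ∀ t < Real.log r, deriv (deriv ℓ) t < 4 * ℓ t := by
  have hneg : ∀ᶠ s in 𝓝 (0 : ℝ), s * deriv (deriv A) s - deriv A s + 3 * s ^ 2 * deriv B s
      + s ^ 3 * deriv (deriv B) s < 0 := by
    have h1 := hA.deriv.continuousAt
    have h2 := hA.deriv.deriv.continuousAt
    have h3 := hB.deriv.continuousAt
    have h4 := hB.deriv.deriv.continuousAt
    have h5 : ContinuousAt (fun s => s * deriv (deriv A) s - deriv A s + 3 * s ^ 2 * deriv B s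
      + s ^ 3 * deriv (deriv B) s) 0 := by fun_prop
    exact h5.eventually_lt_const (by simpa using hA')
  have hall := (hA.eventually_analyticAt.and hB.eventually_analyticAt).and hneg
  obtain ⟨τ, hτ, hball⟩ := Metric.eventually_nhds_iff.1 hall
  have hr : ∀ᶠ r in 𝓝[>] (0 : ℝ), r ^ 2 < τ :=
    ((continuous_pow 2).tendsto' (0 : ℝ) 0 (by simp)).eventually_lt_const hτ
      |>.filter_mono nhdsWithin_le_nhds
  filter_upwards [hr, self_mem_nhdsWithin] with r hr (hr0 : 0 < r) ℓ hℓ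
  have hs : ∀ t < Real.log r, Real.exp (2 * t) ∈ Metric.ball (0 : ℝ) τ := by
    intro t ht
    have h1 : Real.exp t < r := (Real.lt_log_iff_exp_lt hr0).1 ht
    rw [mem_ball_zero_iff, Real.norm_of_nonneg (Real.exp_pos _).le, mul_comm, Real.exp_mul]
    norm_cast
    exact lt_trans (by gcongr) hr
  have hpt : ∀ t < Real.log r, _ := fun t ht => hball (hs t ht)
  have hE : ∀ t : ℝ, HasDerivAt (fun t => Real.exp (2 * t)) (2 * Real.exp (2 * t)) t := by
    intro t
    simpa [mul_comm] using ((hasDerivAt_id t).const_mul 2).exp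
  have hE' : ∀ t : ℝ, HasDerivAt (fun t => Real.exp (-(2 * t))) (-2 * Real.exp (-(2 * t))) t := by
    intro t
    simpa [mul_comm] using ((hasDerivAt_id t).const_mul 2).neg.exp
  have hcomp : ∀ {f : ℝ → ℝ} {t : ℝ}, AnalyticAt ℝ f (Real.exp (2 * t)) →
      HasDerivAt (fun t => f (Real.exp (2 * t)))
        (deriv f (Real.exp (2 * t)) * (2 * Real.exp (2 * t))) t := fun {f t} hf =>
    hf.differentiableAt.hasDerivAt.comp (h₂ := f) t (hE t)
  have hinv : ∀ t : ℝ, Real.exp (-(2 * t)) * Real.exp (2 * t) = 1 := fun t => by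
    rw [← Real.exp_add]; simp
  set ℓ' : ℝ → ℝ := fun t => c * (-2 * Real.exp (-(2 * t)) * A (Real.exp (2 * t))
    + 2 * deriv A (Real.exp (2 * t)) + 2 * Real.exp (2 * t) * B (Real.exp (2 * t))
    + 2 * Real.exp (2 * t) ^ 2 * deriv B (Real.exp (2 * t))) with hℓ'
  have hd1 : Set.EqOn (deriv ℓ) ℓ' (Set.Iio (Real.log r)) := by
    intro t ht
    obtain ⟨⟨hAt, hBt⟩, -⟩ := hpt t ht
    rw [(hℓ.eventuallyEq_of_mem (Iio_mem_nhds ht)).deriv_eq]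
    refine ((((hE' t).mul (hcomp hAt)).add ((hE t).mul (hcomp hBt))).const_mul c).deriv.trans ?_
    simp only [hℓ']
    linear_combination 2 * c * deriv A (Real.exp (2 * t)) * hinv t
  have hd2 : ∀ t < Real.log r, deriv (deriv ℓ) t = 4 * ℓ t + 4 * c * (Real.exp (2 * t)
      * deriv (deriv A) (Real.exp (2 * t)) - deriv A (Real.exp (2 * t))
      + 3 * Real.exp (2 * t) ^ 2 * deriv B (Real.exp (2 * t))
      + Real.exp (2 * t) ^ 3 * deriv (deriv B) (Real.exp (2 * t))) := by
    intro t ht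
    obtain ⟨⟨hAt, hBt⟩, -⟩ := hpt t ht
    rw [(hd1.eventuallyEq_of_mem (Iio_mem_nhds ht)).deriv_eq, hℓ ht]
    refine ((((((hE' t).const_mul (-2)).mul (hcomp hAt)).add ((hcomp hAt.deriv).const_mul 2)).add
      (((hE t).const_mul 2).mul (hcomp hBt))).add
      ((((hE t).pow 2).const_mul 2).mul (hcomp hBt.deriv))).const_mul c |>.deriv.trans ?_
    simp only [Pi.pow_apply]
    linear_combination -4 * c * deriv A (Real.exp (2 * t)) * hinv t
  refine ⟨ContDiffOn.congr (fun t ht => ContDiffAt.contDiffWithinAt ?_) hℓ, fun t ht => ?_⟩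
  · obtain ⟨⟨hAt, hBt⟩, -⟩ := hpt t ht
    have hexp : ContDiffAt ℝ 2 (fun t : ℝ => Real.exp (2 * t)) t := by fun_prop
    have hexp' : ContDiffAt ℝ 2 (fun t : ℝ => Real.exp (-(2 * t))) t := by fun_prop
    exact contDiffAt_const.mul ((hexp'.mul (hAt.contDiffAt.comp t hexp)).add
      (hexp.mul (hBt.contDiffAt.comp t hexp)))
  · rw [hd2 t ht]
    have := (hpt t ht).2
    nlinarith [mul_neg_of_pos_of_neg hc this]

/-! ### The height coordinate and its inverse -/

/-- The numerator of the Gauss map, normalized so that `g = psi ε z / z ^ 2`. -/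
def psi (ε z : ℂ) : ℂ := 1 + ε * z - ε ^ 2 * z ^ 2 / 2

/-- The holomorphic part of a primitive `log z + psiPrim ε z` of `psi ε z / z`. -/
def psiPrim (ε z : ℂ) : ℂ := ε * z - ε ^ 2 * z ^ 2 / 4

/-- The coordinate `w` in which the height of the surface is `log |w|` up to a constant: the
exponential of a primitive of `φ₃`. -/
def heightCoord (ε z : ℂ) : ℂ := z * Complex.exp (psiPrim ε z)

lemma hasDerivAt_psiPrim (ε z : ℂ) : HasDerivAt (psiPrim ε) (ε - ε ^ 2 * z / 2) z := by
  refine (((hasDerivAt_id z).const_mul ε).sub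
    ((((hasDerivAt_id z).pow 2).const_mul (ε ^ 2)).div_const 4)).congr_deriv ?_
  simp
  ring

lemma hasDerivAt_psi (ε z : ℂ) : HasDerivAt (psi ε) (ε - ε ^ 2 * z) z := by
  refine ((((hasDerivAt_id z).const_mul ε).const_add 1).sub
    ((((hasDerivAt_id z).pow 2).const_mul (ε ^ 2)).div_const 2)).congr_deriv ?_
  simp
  ring

lemma hasDerivAt_heightCoord (ε z : ℂ) :
    HasDerivAt (heightCoord ε) (Complex.exp (psiPrim ε z) * psi ε z) z := by
  refine ((hasDerivAt_id z).mul (hasDerivAt_psiPrim ε z).cexp).congr_deriv ?_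
  simp only [psi, id]
  ring

lemma analyticAt_of_hasDerivAt {f f' : ℂ → ℂ} (h : ∀ z, HasDerivAt f (f' z) z) (z : ℂ) :
    AnalyticAt ℂ f z :=
  (show Differentiable ℂ f from fun z => (h z).differentiableAt).analyticAt z

lemma analyticAt_psi (ε z : ℂ) : AnalyticAt ℂ (psi ε) z :=
  analyticAt_of_hasDerivAt (hasDerivAt_psi ε) z

lemma analyticAt_psiPrim (ε z : ℂ) : AnalyticAt ℂ (psiPrim ε) z :=
  analyticAt_of_hasDerivAt (hasDerivAt_psiPrim ε) z

lemma analyticAt_heightCoord (ε z : ℂ) : AnalyticAt ℂ (heightCoord ε) z :=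
  analyticAt_of_hasDerivAt (hasDerivAt_heightCoord ε) z

@[simp] lemma psi_zero (ε : ℂ) : psi ε 0 = 1 := by simp [psi]

@[simp] lemma psiPrim_zero (ε : ℂ) : psiPrim ε 0 = 0 := by simp [psiPrim]

@[simp] lemma heightCoord_zero (ε : ℂ) : heightCoord ε 0 = 0 := by simp [heightCoord]

lemma deriv_heightCoord_zero (ε : ℂ) : deriv (heightCoord ε) 0 = 1 := by
  simp [(hasDerivAt_heightCoord ε 0).deriv]

/-- The local inverse at `0` of the height coordinate. -/
def heightInv (ε : ℂ) : ℂ → ℂ :=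
  (analyticAt_heightCoord ε 0).hasStrictDerivAt.localInverse _ _ _
    (by rw [deriv_heightCoord_zero]; exact one_ne_zero)

lemma analyticAt_heightInv (ε : ℂ) : AnalyticAt ℂ (heightInv ε) 0 := by
  have h := (analyticAt_heightCoord ε 0).analyticAt_localInverse
    (by rw [deriv_heightCoord_zero]; exact one_ne_zero)
  rwa [heightCoord_zero] at h

@[simp] lemma heightInv_zero (ε : ℂ) : heightInv ε 0 = 0 := by
  have h := ((analyticAt_heightCoord ε 0).hasStrictDerivAt.eventually_left_inverse
    (by rw [deriv_heightCoord_zero]; exact one_ne_zero)).self_of_nhds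
  rwa [heightCoord_zero] at h

lemma eventually_heightInv_heightCoord (ε : ℂ) :
    ∀ᶠ z in 𝓝 (0 : ℂ), heightInv ε (heightCoord ε z) = z :=
  (analyticAt_heightCoord ε 0).hasStrictDerivAt.eventually_left_inverse _

lemma eventually_heightCoord_heightInv (ε : ℂ) :
    ∀ᶠ w in 𝓝 (0 : ℂ), heightCoord ε (heightInv ε w) = w := by
  have h := (analyticAt_heightCoord ε 0).hasStrictDerivAt.eventually_right_inverse
    (by rw [deriv_heightCoord_zero]; exact one_ne_zero)
  rwa [heightCoord_zero] at h

lemma deriv_heightInv_zero (ε : ℂ) : deriv (heightInv ε) 0 = 1 := by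
  have h := ((analyticAt_heightCoord ε 0).hasStrictDerivAt.to_localInverse
    (by rw [deriv_heightCoord_zero]; exact one_ne_zero)).hasDerivAt
  rw [heightCoord_zero] at h
  exact h.deriv.trans (by simp [deriv_heightCoord_zero])

lemma tendsto_heightInv (ε : ℂ) : Tendsto (heightInv ε) (𝓝 0) (𝓝 0) := by
  simpa using (analyticAt_heightInv ε).continuousAt.tendsto

/-- The regular factor of `1 / g` in the height coordinate `w`:
`g = (w ^ 2 * gaussFactor ε w)⁻¹`. -/
def gaussFactor (ε w : ℂ) : ℂ :=
  Complex.exp (-(2 * psiPrim ε (heightInv ε w))) * (psi ε (heightInv ε w))⁻¹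

/-- A holomorphic square root of `gaussFactor` near `0`. -/
def gaussRoot (ε w : ℂ) : ℂ :=
  Complex.exp (-psiPrim ε (heightInv ε w)) *
    Complex.exp (-(Complex.log (psi ε (heightInv ε w)) / 2))

lemma hasDerivAt_heightInv_zero (ε : ℂ) : HasDerivAt (heightInv ε) 1 0 := by
  rw [← deriv_heightInv_zero ε]
  exact (analyticAt_heightInv ε).differentiableAt.hasDerivAt

lemma hasDerivAt_psiPrim_heightInv_zero (ε : ℂ) :
    HasDerivAt (fun w => psiPrim ε (heightInv ε w)) ε 0 :=
  (HasDerivAt.comp (h₂ := psiPrim ε) 0 (by simpa using hasDerivAt_psiPrim ε 0)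
    (hasDerivAt_heightInv_zero ε)).congr_deriv (by simp)

lemma hasDerivAt_psi_heightInv_zero (ε : ℂ) :
    HasDerivAt (fun w => psi ε (heightInv ε w)) ε 0 :=
  (HasDerivAt.comp (h₂ := psi ε) 0 (by simpa using hasDerivAt_psi ε 0)
    (hasDerivAt_heightInv_zero ε)).congr_deriv (by simp)

lemma hasDerivAt_gaussFactor_zero (ε : ℂ) : HasDerivAt (gaussFactor ε) (-3 * ε) 0 := by
  have h0 := hasDerivAt_psiPrim_heightInv_zero ε
  have h1 := hasDerivAt_psi_heightInv_zero ε
  refine ((h0.const_mul 2).neg.cexp.mul (h1.inv (by simp))).congr_deriv ?_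
  simp
  ring

lemma hasDerivAt_gaussRoot_zero (ε : ℂ) : HasDerivAt (gaussRoot ε) (-(3 / 2) * ε) 0 := by
  have h0 := hasDerivAt_psiPrim_heightInv_zero ε
  have h1 := hasDerivAt_psi_heightInv_zero ε
  refine (h0.neg.cexp.mul ((h1.clog (by simp)).div_const 2).neg.cexp).congr_deriv ?_
  simp
  ring

lemma analyticAt_gaussRoot (ε : ℂ) : AnalyticAt ℂ (gaussRoot ε) 0 := by
  have h1 := (analyticAt_psiPrim ε (heightInv ε 0)).fun_comp (analyticAt_heightInv ε)
  have h2 := (analyticAt_psi ε (heightInv ε 0)).fun_comp (analyticAt_heightInv ε)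
  exact h1.neg.cexp.mul ((h2.clog (by simp)).div_const (c := 2)).neg.cexp

lemma gaussRoot_ne_zero (ε w : ℂ) : gaussRoot ε w ≠ 0 :=
  mul_ne_zero (Complex.exp_ne_zero _) (Complex.exp_ne_zero _)

lemma gaussRoot_sq {ε w : ℂ} (h : psi ε (heightInv ε w) ≠ 0) :
    gaussRoot ε w ^ 2 = gaussFactor ε w := by
  rw [gaussRoot, gaussFactor, mul_pow, ← Complex.exp_nat_mul, ← Complex.exp_nat_mul]
  rw [show ((2 : ℕ) : ℂ) * -(Complex.log (psi ε (heightInv ε w)) / 2)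
    = -Complex.log (psi ε (heightInv ε w)) by push_cast; ring, Complex.exp_neg (Complex.log _),
    Complex.exp_log h]
  push_cast
  ring_nf

/-- A disc of radius `R` is small enough for `ε` if on it the height coordinate is invertible,
with inverse close to the identity, and `psi` has no zeros. -/
structure IsGoodRadius (ε : ℂ) (R : ℝ) : Prop where
  analyticAt : ∀ w ∈ ball (0 : ℂ) R, AnalyticAt ℂ (heightInv ε) w
  right_inv : ∀ w ∈ ball (0 : ℂ) R, heightCoord ε (heightInv ε w) = w
  left_inv : ∀ z ∈ ball (0 : ℂ) R, heightInv ε (heightCoord ε z) = z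
  norm_le : ∀ w ∈ ball (0 : ℂ) R, ‖heightInv ε w‖ ≤ 2 * ‖w‖
  le_norm : ∀ w ∈ ball (0 : ℂ) R, ‖w‖ ≤ 2 * ‖heightInv ε w‖
  psi_heightInv_ne_zero : ∀ w ∈ ball (0 : ℂ) R, psi ε (heightInv ε w) ≠ 0
  psi_ne_zero : ∀ z ∈ ball (0 : ℂ) R, psi ε z ≠ 0

theorem exists_isGoodRadius (ε : ℂ) : ∃ R > 0, IsGoodRadius ε R := by
  have hexp : ∀ᶠ z in 𝓝 (0 : ℂ), ‖Complex.exp (psiPrim ε z)‖ < 2 ∧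
      1 / 2 < ‖Complex.exp (psiPrim ε z)‖ := by
    have h : ContinuousAt (fun z => ‖Complex.exp (psiPrim ε z)‖) 0 :=
      (analyticAt_psiPrim ε 0).cexp.continuousAt.norm
    exact (h.eventually_lt_const (by norm_num)).and
      (h.eventually_const_lt (by norm_num))
  have hpsi : ∀ᶠ z in 𝓝 (0 : ℂ), psi ε z ≠ 0 :=
    (analyticAt_psi ε 0).continuousAt.eventually_ne (by simp)
  obtain ⟨R, hR, hball⟩ := Metric.eventually_nhds_iff_ball.1
    ((((analyticAt_heightInv ε).eventually_analyticAt.and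
      (eventually_heightCoord_heightInv ε)).and
      ((tendsto_heightInv ε).eventually (hexp.and hpsi))).and
      ((eventually_heightInv_heightCoord ε).and hpsi))
  have hnorm : ∀ w ∈ ball (0 : ℂ) R,
      ‖heightInv ε w‖ * ‖Complex.exp (psiPrim ε (heightInv ε w))‖ = ‖w‖ := by
    intro w hw
    rw [← norm_mul]
    exact congrArg _ (hball w hw).1.1.2
  refine ⟨R, hR, fun w hw => (hball w hw).1.1.1, fun w hw => (hball w hw).1.1.2,
    fun w hw => (hball w hw).2.1, fun w hw => ?_, fun w hw => ?_,
    fun w hw => (hball w hw).1.2.2, fun w hw => (hball w hw).2.2⟩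
  · have h1 := (hball w hw).1.2.1.2
    have := norm_nonneg (heightInv ε w)
    nlinarith [hnorm w hw]
  · have h1 := (hball w hw).1.2.1.1
    have := norm_nonneg (heightInv ε w)
    nlinarith [hnorm w hw]

namespace IsGoodRadius

variable {ε w : ℂ} {R : ℝ}

lemma mono (h : IsGoodRadius ε R) {R' : ℝ} (hR : R' ≤ R) : IsGoodRadius ε R' where
  analyticAt w hw := h.analyticAt w (ball_subset_ball hR hw)
  right_inv w hw := h.right_inv w (ball_subset_ball hR hw)
  left_inv w hw := h.left_inv w (ball_subset_ball hR hw)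
  norm_le w hw := h.norm_le w (ball_subset_ball hR hw)
  le_norm w hw := h.le_norm w (ball_subset_ball hR hw)
  psi_heightInv_ne_zero w hw := h.psi_heightInv_ne_zero w (ball_subset_ball hR hw)
  psi_ne_zero w hw := h.psi_ne_zero w (ball_subset_ball hR hw)

lemma heightInv_ne_zero (h : IsGoodRadius ε R) (hw : w ∈ ball (0 : ℂ) R) (hw0 : w ≠ 0) :
    heightInv ε w ≠ 0 := by
  intro h0
  have := h.right_inv w hw
  rw [h0, heightCoord_zero] at this
  exact hw0 this.symm

lemma mul_exp (h : IsGoodRadius ε R) (hw : w ∈ ball (0 : ℂ) R) :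
    heightInv ε w * Complex.exp (psiPrim ε (heightInv ε w)) = w :=
  h.right_inv w hw

/-- In the coordinate `w`, the form `φ₃ = psi ε z / z dz` is `dw / w`. -/
lemma deriv_heightInv (h : IsGoodRadius ε R) (hw : w ∈ ball (0 : ℂ) R) (hw0 : w ≠ 0) :
    psi ε (heightInv ε w) / heightInv ε w * deriv (heightInv ε) w = w⁻¹ := by
  have h1 : HasDerivAt (fun w => heightCoord ε (heightInv ε w))
      (Complex.exp (psiPrim ε (heightInv ε w)) * psi ε (heightInv ε w) *
        deriv (heightInv ε) w) w :=
    (hasDerivAt_heightCoord ε _).comp w (h.analyticAt w hw).differentiableAt.hasDerivAt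
  have h2 : HasDerivAt (fun w => heightCoord ε (heightInv ε w)) 1 w :=
    (hasDerivAt_id w).congr_of_eventuallyEq
      (Filter.eventuallyEq_of_mem (isOpen_ball.mem_nhds hw) h.right_inv)
  have h3 := h1.unique h2
  have h4 := h.heightInv_ne_zero hw hw0
  have h5 := h.mul_exp hw
  refine eq_inv_of_mul_eq_one_left ?_
  rw [div_mul_eq_mul_div, div_mul_eq_mul_div, div_eq_one_iff_eq h4]
  linear_combination (heightInv ε w) * h3
    - psi ε (heightInv ε w) * deriv (heightInv ε) w * h5

lemma deriv_heightInv_ne_zero (h : IsGoodRadius ε R) (hw : w ∈ ball (0 : ℂ) R) (hw0 : w ≠ 0) :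
    deriv (heightInv ε) w ≠ 0 := by
  intro h0
  have := h.deriv_heightInv hw hw0
  rw [h0, mul_zero] at this
  exact inv_ne_zero hw0 this.symm

lemma psi_div_sq (h : IsGoodRadius ε R) (hw : w ∈ ball (0 : ℂ) R) (hw0 : w ≠ 0) :
    psi ε (heightInv ε w) / heightInv ε w ^ 2 = (w ^ 2 * gaussFactor ε w)⁻¹ := by
  have h4 := h.heightInv_ne_zero hw hw0
  have h5 := h.psi_heightInv_ne_zero w hw
  have h6 := Complex.exp_ne_zero (psiPrim ε (heightInv ε w))
  have h7 : w ^ 2 * gaussFactor ε w = heightInv ε w ^ 2 * (psi ε (heightInv ε w))⁻¹ := by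
    nth_rewrite 1 [← h.mul_exp hw]
    rw [gaussFactor, Complex.exp_neg, two_mul, Complex.exp_add]
    field_simp
  rw [h7, mul_inv, inv_inv, div_eq_inv_mul]

lemma differentiableOn_gaussFactor (h : IsGoodRadius ε R) :
    DifferentiableOn ℂ (gaussFactor ε) (ball 0 R) := by
  intro w hw
  have h1 := (h.analyticAt w hw).differentiableAt
  have h2 := (analyticAt_psiPrim ε (heightInv ε w)).differentiableAt.fun_comp' w h1
  have h3 := (analyticAt_psi ε (heightInv ε w)).differentiableAt.fun_comp' w h1
  exact ((h2.const_mul 2).neg.cexp.mul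
    (h3.inv (h.psi_heightInv_ne_zero w hw))).differentiableWithinAt

lemma gaussFactor_ne_zero (h : IsGoodRadius ε R) (hw : w ∈ ball (0 : ℂ) R) :
    gaussFactor ε w ≠ 0 :=
  mul_ne_zero (Complex.exp_ne_zero _) (inv_ne_zero (h.psi_heightInv_ne_zero w hw))

end IsGoodRadius

/-! ### Real parts of holomorphic curves -/

/-- The real linear map `v ↦ (Re (a j * v))_j`, the differential of the real part of a
holomorphic curve with derivative `a`. -/
def reVec (a : Fin 3 → ℂ) : ℂ →L[ℝ] E3 :=
  (EuclideanSpace.equiv (Fin 3) ℝ).symm.toContinuousLinearMap ∘L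
    ContinuousLinearMap.pi fun j => Complex.reCLM ∘L (a j • (1 : ℂ →L[ℝ] ℂ))

@[simp] lemma reVec_apply (a : Fin 3 → ℂ) (v : ℂ) (j : Fin 3) : reVec a v j = (a j * v).re := by
  simp [reVec]

/-- Near `z`, the map `F` is the real part of a holomorphic curve whose derivative is `a`. -/
def IsReIntegralAt (F : ℂ → E3) (a : Fin 3 → ℂ → ℂ) (z : ℂ) : Prop :=
  ∃ Φ : Fin 3 → ℂ → ℂ, ∀ᶠ w in 𝓝 z, ∀ j, F w j = (Φ j w).re ∧ HasDerivAt (Φ j) (a j w) w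

namespace IsReIntegralAt

variable {F : ℂ → E3} {a : Fin 3 → ℂ → ℂ} {z : ℂ}

lemma hasFDerivAt (h : IsReIntegralAt F a z) : HasFDerivAt F (reVec fun j => a j z) z := by
  obtain ⟨Φ, hΦ⟩ := h
  rw [← hasFDerivWithinAt_univ, hasFDerivWithinAt_euclidean]
  intro j
  have h1 : HasFDerivAt (fun w => (Φ j w).re)
      (Complex.reCLM ∘L (a j z • (1 : ℂ →L[ℝ] ℂ))) z := by
    have h2 := Complex.reCLM.hasFDerivAt.comp z
      ((hΦ.self_of_nhds j).2.hasFDerivAt.restrictScalars ℝ)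
    refine h2.congr_fderiv ?_
    ext
    simp [mul_comm]
  refine ((h1.congr_of_eventuallyEq (hΦ.mono fun w hw => (hw j).1)).congr_fderiv
    ?_).hasFDerivWithinAt
  ext
  simp [reVec_apply]

lemma differentiableAt (h : IsReIntegralAt F a z) : DifferentiableAt ℝ F z :=
  h.hasFDerivAt.differentiableAt

lemma phi_eq (h : IsReIntegralAt F a z) (j : Fin 3) : phi F j z = a j z := by
  rw [phi, h.hasFDerivAt.fderiv, reVec_apply, reVec_apply]
  apply Complex.ext <;> simp

lemma comp {T T' : ℂ → ℂ} (h : IsReIntegralAt F a (T z))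
    (hT : ∀ᶠ w in 𝓝 z, HasDerivAt T (T' w) w) :
    IsReIntegralAt (F ∘ T) (fun j w => a j (T w) * T' w) z := by
  obtain ⟨Φ, hΦ⟩ := h
  refine ⟨fun j => Φ j ∘ T, ?_⟩
  filter_upwards [hT.self_of_nhds.continuousAt.eventually hΦ, hT] with w hw hTw j
  exact ⟨(hw j).1, (hw j).2.comp w hTw⟩

lemma harmonicAt (h : IsReIntegralAt F a z) : InnerProductSpace.HarmonicAt F z := by
  obtain ⟨Φ, hΦ⟩ := h
  have hj : ∀ j, InnerProductSpace.HarmonicAt (fun w => EuclideanSpace.single j (Φ j w).re) z := by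
    intro j
    have h1 : AnalyticAt ℂ (Φ j) z := Complex.analyticAt_iff_eventually_differentiableAt.2
      (hΦ.mono fun w hw => (hw j).2.differentiableAt)
    have h2 := h1.harmonicAt_re.comp_CLM
      ((1 : ℝ →L[ℝ] ℝ).smulRight (EuclideanSpace.single j (1 : ℝ)))
    convert! h2 using 1
    ext w i
    simp
  refine (InnerProductSpace.harmonicAt_congr_nhds ?_).1 (((hj 0).add (hj 1)).add (hj 2))
  filter_upwards [hΦ] with w hw
  ext i
  fin_cases i <;> simp [(hw _).1]

end IsReIntegralAt

/-- The derivative `(f (1 - g ^ 2) / 2, i f (1 + g ^ 2) / 2, f g)` of the null curve with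
Weierstrass data `f`, `g`. -/
def weierstrassVec (f g : ℂ) : Fin 3 → ℂ :=
  ![f * (1 - g ^ 2) / 2, Complex.I * f * (1 + g ^ 2) / 2, f * g]

lemma inner_reVec_weierstrassVec (f g u v : ℂ) :
    inner ℝ (reVec (weierstrassVec f g) u) (reVec (weierstrassVec f g) v)
      = (‖f‖ * (1 + ‖g‖ ^ 2) / 2) ^ 2 * inner ℝ u v := by
  have hf := Complex.sq_norm f
  have hg := Complex.sq_norm g
  rw [Complex.normSq_apply] at hf hg
  rw [show (‖f‖ * (1 + ‖g‖ ^ 2) / 2) ^ 2 = ‖f‖ ^ 2 * (1 + ‖g‖ ^ 2) ^ 2 / 4 by ring, hf, hg,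
    Complex.inner]
  simp only [PiLp.inner_apply, Fin.sum_univ_three, reVec_apply, weierstrassVec]
  simp [pow_two]
  ring

lemma norm_reVec_weierstrassVec (f g v : ℂ) :
    ‖reVec (weierstrassVec f g) v‖ = ‖f‖ * (1 + ‖g‖ ^ 2) / 2 * ‖v‖ := by
  have h := inner_reVec_weierstrassVec f g v v
  rw [real_inner_self_eq_norm_sq, real_inner_self_eq_norm_sq, ← mul_pow] at h
  exact (pow_left_inj₀ (norm_nonneg _) (by positivity) two_ne_zero).1 h

namespace IsReIntegralAt

variable {F : ℂ → E3} {f g : ℂ → ℂ} {z : ℂ}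

lemma conformalAt (h : IsReIntegralAt F (fun j w => weierstrassVec (f w) (g w) j) z)
    (hf : f z ≠ 0) : ConformalAt F z := by
  have hpos : 0 < ‖f z‖ := norm_pos_iff.2 hf
  exact ⟨_, h.hasFDerivAt, (isConformalMap_iff _).2
    ⟨_, by positivity, inner_reVec_weierstrassVec (f z) (g z)⟩⟩

lemma phi_sub_eq (h : IsReIntegralAt F (fun j w => weierstrassVec (f w) (g w) j) z) :
    phi F 0 z - Complex.I * phi F 1 z = f z := by
  rw [h.phi_eq, h.phi_eq]
  simp only [weierstrassVec, Matrix.cons_val]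
  linear_combination -(f z * (1 + g z ^ 2) / 2) * Complex.I_sq

lemma gaussMap_eq (h : IsReIntegralAt F (fun j w => weierstrassVec (f w) (g w) j) z)
    (hf : f z ≠ 0) : gaussMap F z = g z := by
  rw [gaussMap, h.phi_sub_eq, h.phi_eq]
  simp only [weierstrassVec, Matrix.cons_val]
  field_simp

lemma tangential_eq {a : Fin 3 → ℂ → ℂ} {r θ : ℝ} (h : IsReIntegralAt F a (circleMap 0 r θ)) :
    tangential F r θ
      = reVec (fun j => a j (circleMap 0 r θ)) (circleMap 0 r θ * Complex.I) :=
  (h.hasFDerivAt.comp_hasDerivAt θ (hasDerivAt_circleMap 0 r θ)).deriv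

lemma radial_eq {a : Fin 3 → ℂ → ℂ} {r θ : ℝ} (h : IsReIntegralAt F a (circleMap 0 r θ)) :
    radial F r θ
      = reVec (fun j => a j (circleMap 0 r θ)) (Complex.exp (θ * Complex.I)) := by
  have h1 : HasDerivAt (fun s : ℝ => circleMap 0 s θ) (Complex.exp (θ * Complex.I)) r := by
    simpa [circleMap] using (Complex.ofRealCLM.hasDerivAt (x := r)).mul_const
      (Complex.exp (θ * Complex.I))
  exact (h.hasFDerivAt.comp_hasDerivAt r h1).deriv

/-- For a conformal map the length element times the unit conormal is `r ∂F/∂r dθ`. -/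
lemma norm_tangential_smul {r θ : ℝ} (hr : 0 < r)
    (h : IsReIntegralAt F (fun j w => weierstrassVec (f w) (g w) j) (circleMap 0 r θ))
    (hf : f (circleMap 0 r θ) ≠ 0) :
    ‖tangential F r θ‖ • (‖radial F r θ‖⁻¹ • radial F r θ)
      = reVec (fun j => weierstrassVec (f (circleMap 0 r θ)) (g (circleMap 0 r θ)) j)
          (circleMap 0 r θ) := by
  have hpos : 0 < ‖f (circleMap 0 r θ)‖ := norm_pos_iff.2 hf
  have h1 : circleMap 0 r θ = r • Complex.exp (θ * Complex.I) := by simp [circleMap]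
  have h2 : ∀ A, reVec A (circleMap 0 r θ) = r • reVec A (Complex.exp (θ * Complex.I)) := by
    intro A
    rw [← map_smul, ← h1]
  rw [h.tangential_eq, h.radial_eq, norm_reVec_weierstrassVec, norm_reVec_weierstrassVec,
    smul_smul, h2]
  congr 1
  rw [norm_mul, norm_circleMap_zero, Complex.norm_exp_ofReal_mul_I, Complex.norm_I, abs_of_pos hr]
  field_simp

lemma norm_tangential {r θ : ℝ} (hr : 0 < r)
    (h : IsReIntegralAt F (fun j w => weierstrassVec (f w) (g w) j) (circleMap 0 r θ)) :
    ‖tangential F r θ‖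
      = ‖f (circleMap 0 r θ)‖ * (1 + ‖g (circleMap 0 r θ)‖ ^ 2) / 2 * r := by
  rw [h.tangential_eq, norm_reVec_weierstrassVec, norm_mul, norm_circleMap_zero, Complex.norm_I,
    abs_of_pos hr, mul_one]

end IsReIntegralAt

/-- A derivative of a single-valued function has no residue. -/
lemma integral_re_mul_circleMap_eq_zero {Φ a : ℂ → ℂ} {r : ℝ} (hr : 0 ≤ r)
    (h : ∀ w, ‖w‖ = r → HasDerivAt Φ (a w) w)
    (ha : Continuous fun θ => a (circleMap 0 r θ)) :
    ∫ θ in (0 : ℝ)..(2 * π), (a (circleMap 0 r θ) * circleMap 0 r θ).re = 0 := by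
  have h1 : (∮ w in C(0, r), a w) = 0 :=
    circleIntegral.integral_eq_zero_of_hasDerivWithinAt hr fun w hw =>
      (h w (by simpa using hw)).hasDerivWithinAt
  have h2 : ∫ θ in (0 : ℝ)..(2 * π), a (circleMap 0 r θ) * circleMap 0 r θ = 0 := by
    rw [circleIntegral] at h1
    simp only [deriv_circleMap, smul_eq_mul] at h1
    have h3 : ∀ θ : ℝ, circleMap 0 r θ * Complex.I * a (circleMap 0 r θ)
        = Complex.I * (a (circleMap 0 r θ) * circleMap 0 r θ) := fun θ => by ring
    simp only [h3, intervalIntegral.integral_const_mul] at h1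
    exact (mul_eq_zero.1 h1).resolve_left Complex.I_ne_zero
  have h4 := Complex.reCLM.intervalIntegral_comp_comm
    ((ha.mul (continuous_circleMap 0 r)).intervalIntegrable (μ := MeasureTheory.volume) 0 (2 * π))
  simpa [h2] using h4

lemma continuous_weierstrassVec {ι : Type*} [TopologicalSpace ι] {f g : ι → ℂ} (hf : Continuous f)
    (hg : Continuous g) (j : Fin 3) : Continuous fun x => weierstrassVec (f x) (g x) j := by
  simp only [weierstrassVec]
  fin_cases j <;> simp <;> fun_prop

lemma continuous_reVec {ι : Type*} [TopologicalSpace ι] {a : Fin 3 → ι → ℂ} {v : ι → ℂ}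
    (ha : ∀ j, Continuous (a j)) (hv : Continuous v) :
    Continuous fun x => reVec (fun j => a j x) (v x) := by
  rw [show (fun x => reVec (fun j => a j x) (v x))
    = fun x => WithLp.toLp 2 fun j => (a j x * v x).re by ext x j; simp]
  exact (PiLp.continuous_toLp 2 _).comp
    (continuous_pi fun j => Complex.continuous_re.comp ((ha j).mul hv))

/-- The components of the flux are the real parts of `∫ φ_j w dθ`, the imaginary parts of the
periods of `φ_j dw`. -/
lemma flux_apply {F : ℂ → E3} {f g : ℂ → ℂ} {r : ℝ} (hr : 0 < r)
    (h : ∀ θ, IsReIntegralAt F (fun j w => weierstrassVec (f w) (g w) j) (circleMap 0 r θ))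
    (hf : ∀ θ, f (circleMap 0 r θ) ≠ 0) (hfc : Continuous fun θ => f (circleMap 0 r θ))
    (hgc : Continuous fun θ => g (circleMap 0 r θ)) (j : Fin 3) :
    flux F r j = ∫ θ in (0 : ℝ)..(2 * π),
      (weierstrassVec (f (circleMap 0 r θ)) (g (circleMap 0 r θ)) j * circleMap 0 r θ).re := by
  have hcont := continuous_reVec (continuous_weierstrassVec hfc hgc) (continuous_circleMap 0 r)
  have h1 := (EuclideanSpace.proj j : E3 →L[ℝ] ℝ).intervalIntegral_comp_comm
    (hcont.intervalIntegrable (μ := MeasureTheory.volume) 0 (2 * π))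
  simp only [PiLp.proj_apply, reVec_apply] at h1
  rw [h1, flux]
  simp only [fun θ => (h θ).norm_tangential_smul hr (hf θ)]

/-! ### Annuli whose height is logarithmic -/

lemma isOpen_annulus (R₀ R₁ : ℝ) : IsOpen (annulus R₀ R₁) :=
  (isOpen_lt continuous_const continuous_norm).inter (isOpen_lt continuous_norm continuous_const)

/-- The closed annulus `{R₀ ≤ |z| ≤ R₁}`. -/
def closedAnnulus (R₀ R₁ : ℝ) : Set ℂ := {z | R₀ ≤ ‖z‖ ∧ ‖z‖ ≤ R₁}

lemma isClosed_closedAnnulus (R₀ R₁ : ℝ) : IsClosed (closedAnnulus R₀ R₁) :=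
  (isClosed_le continuous_const continuous_norm).inter
    (isClosed_le continuous_norm continuous_const)

lemma isCompact_closedAnnulus (R₀ R₁ : ℝ) : IsCompact (closedAnnulus R₀ R₁) :=
  (isCompact_closedBall (0 : ℂ) R₁).of_isClosed_subset (isClosed_closedAnnulus R₀ R₁)
    fun z hz => by simpa using hz.2

lemma annulus_subset_closedAnnulus (R₀ R₁ : ℝ) : annulus R₀ R₁ ⊆ closedAnnulus R₀ R₁ :=
  fun _ hz => ⟨hz.1.le, hz.2.le⟩

lemma closedAnnulus_subset_closure {R₀ R₁ : ℝ} (h0 : 0 < R₀) (h : R₀ < R₁) :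
    closedAnnulus R₀ R₁ ⊆ closure (annulus R₀ R₁) := by
  intro z hz
  have hz0 : 0 < ‖z‖ := h0.trans_le hz.1
  have hcont : ContinuousAt (fun s : ℝ => (s / ‖z‖ : ℝ) • z) ‖z‖ := by fun_prop
  have hz' : (‖z‖ / ‖z‖ : ℝ) • z = z := by rw [div_self hz0.ne', one_smul]
  have hmem : ‖z‖ ∈ closure (Set.Ioo R₀ R₁) := by
    rw [closure_Ioo h.ne]
    exact hz
  have h2 := mem_closure_image hcont hmem
  simp only [hz'] at h2
  refine closure_mono ?_ h2
  rintro _ ⟨s, hs, rfl⟩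
  have : ‖(s / ‖z‖ : ℝ) • z‖ = s := by
    rw [norm_smul, Real.norm_of_nonneg (div_nonneg (h0.trans hs.1).le hz0.le)]
    field_simp
  exact ⟨by rw [this]; exact hs.1, by rw [this]; exact hs.2⟩

/-- A conformal harmonic map whose height is `log |w| + b` is proper into the slab it spans. -/
theorem isMinimalAnnulus_of_height {F : ℂ → E3} {h b R₀ R₁ : ℝ} (hR₀ : 0 < R₀) (hR : R₀ < R₁)
    (hlog₀ : Real.log R₀ + b = -h) (hlog₁ : Real.log R₁ + b = h)
    (hcont : ContinuousOn F (closedAnnulus R₀ R₁))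
    (hheight : ∀ w ∈ closedAnnulus R₀ R₁, F w 2 = Real.log ‖w‖ + b)
    (hharm : InnerProductSpace.HarmonicOnNhd F (annulus R₀ R₁))
    (hconf : ∀ w ∈ annulus R₀ R₁, ConformalAt F w) :
    IsMinimalAnnulus h R₀ R₁ F := by
  have hR₁ : 0 < R₁ := hR₀.trans hR
  have hproj : Continuous fun p : E3 => p 2 := by fun_prop
  have hmaps : Set.MapsTo F (annulus R₀ R₁) (slab h) := by
    intro w hw
    have h1 := hheight w (annulus_subset_closedAnnulus _ _ hw)
    have h2 := Real.log_lt_log hR₀ hw.1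
    have h3 := Real.log_lt_log (hR₀.trans hw.1) hw.2
    exact ⟨by rw [h1]; linarith, by rw [h1]; linarith⟩
  have hmem : ∀ w ∈ closedAnnulus R₀ R₁, F w ∈ slab h → w ∈ annulus R₀ R₁ := by
    intro w hw hFw
    have hw0 : 0 < ‖w‖ := hR₀.trans_le hw.1
    obtain ⟨h1, h2⟩ := hFw
    rw [hheight w hw] at h1 h2
    exact ⟨(Real.log_lt_log_iff hR₀ hw0).1 (by linarith),
      (Real.log_lt_log_iff hw0 hR₁).1 (by linarith)⟩
  have hproper : ∀ K : Set E3, K ⊆ slab h → IsCompact K →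
      IsCompact (annulus R₀ R₁ ∩ F ⁻¹' K) := by
    intro K hK hKc
    have : annulus R₀ R₁ ∩ F ⁻¹' K = closedAnnulus R₀ R₁ ∩ F ⁻¹' K := by
      refine Set.Subset.antisymm
        (Set.inter_subset_inter_left _ (annulus_subset_closedAnnulus _ _)) fun w hw => ?_
      exact ⟨hmem w hw.1 (hK hw.2), hw.2⟩
    rw [this]
    exact (isCompact_closedAnnulus R₀ R₁).of_isClosed_subset
      (hcont.preimage_isClosed_of_isClosed (isClosed_closedAnnulus _ _) hKc.isClosed)
      Set.inter_subset_left
  have himage : IsCompact (F '' closedAnnulus R₀ R₁) :=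
    (isCompact_closedAnnulus R₀ R₁).image_of_continuousOn hcont
  have hclosure : closure (F '' annulus R₀ R₁) = F '' closedAnnulus R₀ R₁ := by
    refine Set.Subset.antisymm (closure_minimal
      (Set.image_mono (annulus_subset_closedAnnulus _ _)) himage.isClosed) ?_
    have h1 : closure (annulus R₀ R₁) = closedAnnulus R₀ R₁ :=
      Set.Subset.antisymm (closure_minimal (annulus_subset_closedAnnulus _ _)
        (isClosed_closedAnnulus _ _)) (closedAnnulus_subset_closure hR₀ hR)
    rw [← h1]
    exact ContinuousOn.image_closure (by rwa [h1])
  have hbd : ∀ R ∈ Set.Icc R₀ R₁, ∀ c, Real.log R + b = c →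
      (closure (F '' annulus R₀ R₁) ∩ plane c).Nonempty := by
    intro R hRm c hc
    have hR0 : 0 < R := hR₀.trans_le hRm.1
    have hRn : ‖(R : ℂ)‖ = R := by simp [hR0.le]
    have hRc : (R : ℂ) ∈ closedAnnulus R₀ R₁ := by
      rw [closedAnnulus, Set.mem_ofPred_eq, hRn]
      exact hRm
    refine ⟨F R, ?_, ?_⟩
    · rw [hclosure]
      exact Set.mem_image_of_mem F hRc
    · change F R 2 = c
      rw [hheight _ hRc, hRn, hc]
  refine ⟨hR₀, hR, hmaps, hharm, hconf, hproper, ?_, hbd R₁ ⟨hR.le, le_rfl⟩ h hlog₁,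
    hbd R₀ ⟨le_rfl, hR.le⟩ (-h) hlog₀⟩
  rw [hclosure]
  rintro _ ⟨⟨w, hw, rfl⟩, hnot⟩
  by_contra hplane
  refine hnot (Set.mem_image_of_mem F (hmem w hw ?_))
  have hw0 : 0 < ‖w‖ := hR₀.trans_le hw.1
  have h1 : F w 2 ≠ h := fun h' => hplane (Or.inl h')
  have h2 : F w 2 ≠ -h := fun h' => hplane (Or.inr h')
  have h3 := Real.log_le_log hR₀ hw.1
  have h4 := Real.log_le_log hw0 hw.2
  have h5 := hheight w hw
  exact ⟨lt_of_le_of_ne (by linarith) h2.symm, lt_of_le_of_ne (by linarith) h1⟩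

/-! ### The surface -/

/-- A primitive of `φ₁ = f (1 - g ^ 2) / 2` for `f = z`, `g = psi ε z / z ^ 2`; it is single-valued
because `psi ε z ^ 2` has no term of degree two. -/
def prim₁ (ε z : ℂ) : ℂ :=
  z ^ 2 / 4 + (z ^ 2)⁻¹ / 4 + ε * z⁻¹ + ε ^ 3 * z / 2 - ε ^ 4 * z ^ 2 / 16

/-- A primitive of `φ₂ = i f (1 + g ^ 2) / 2` for `f = z`, `g = psi ε z / z ^ 2`. -/
def prim₂ (ε z : ℂ) : ℂ :=
  Complex.I * (z ^ 2 / 4 - (z ^ 2)⁻¹ / 4 - ε * z⁻¹ - ε ^ 3 * z / 2 + ε ^ 4 * z ^ 2 / 16)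

lemma hasDerivAt_prim₁ (ε : ℂ) {z : ℂ} (hz : z ≠ 0) :
    HasDerivAt (prim₁ ε) (weierstrassVec z (psi ε z / z ^ 2) 0) z := by
  have hp := hasDerivAt_pow 2 z
  have hi := hasDerivAt_inv hz
  refine (((((hp.div_const 4).add ((hp.inv (pow_ne_zero 2 hz)).div_const 4)).add
    (hi.const_mul ε)).add (((hasDerivAt_id z).const_mul (ε ^ 3)).div_const 2)).sub
    ((hp.const_mul (ε ^ 4)).div_const 16)).congr_deriv ?_
  simp only [weierstrassVec, Matrix.cons_val, psi]
  field_simp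
  ring

lemma hasDerivAt_prim₂ (ε : ℂ) {z : ℂ} (hz : z ≠ 0) :
    HasDerivAt (prim₂ ε) (weierstrassVec z (psi ε z / z ^ 2) 1) z := by
  have hp := hasDerivAt_pow 2 z
  have hi := hasDerivAt_inv hz
  refine ((((((hp.div_const 4).sub ((hp.inv (pow_ne_zero 2 hz)).div_const 4)).sub
    (hi.const_mul ε)).sub (((hasDerivAt_id z).const_mul (ε ^ 3)).div_const 2)).add
    ((hp.const_mul (ε ^ 4)).div_const 16)).const_mul Complex.I).congr_deriv ?_
  simp only [weierstrassVec, Matrix.cons_val, psi]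
  field_simp
  ring

/-- The minimal surface with Weierstrass data `f = z`, `g = psi ε z / z ^ 2`, translated
vertically by `b`. -/
def surface (ε : ℂ) (b : ℝ) (z : ℂ) : E3 :=
  !₂[(prim₁ ε z).re, (prim₂ ε z).re, Real.log ‖heightCoord ε z‖ + b]

lemma isReIntegralAt_surface (ε : ℂ) (b : ℝ) {z : ℂ} (hz : z ≠ 0) :
    IsReIntegralAt (surface ε b) (fun j w => weierstrassVec w (psi ε w / w ^ 2) j) z := by
  -- near `z`, `log |w|` is the real part of the branch `log (w / z) + log |z|`
  refine ⟨![prim₁ ε, prim₂ ε,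
    fun w => Complex.log (w / z) + (psiPrim ε w + (Real.log ‖z‖ + b : ℝ))], ?_⟩
  have hslit : ∀ᶠ w in 𝓝 z, w / z ∈ Complex.slitPlane := by
    have h1 : ContinuousAt (fun w : ℂ => w / z) z := by fun_prop
    refine h1.eventually (Complex.isOpen_slitPlane.mem_nhds ?_)
    simp only [div_self hz]
    exact Complex.one_mem_slitPlane
  filter_upwards [hslit, isOpen_ne.mem_nhds hz] with w hw (hw0 : w ≠ 0) j
  fin_cases j
  · exact ⟨rfl, hasDerivAt_prim₁ ε hw0⟩
  · exact ⟨rfl, hasDerivAt_prim₂ ε hw0⟩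
  · constructor
    · change Real.log ‖w * Complex.exp (psiPrim ε w)‖ + b
        = (Complex.log (w / z) + (psiPrim ε w + (Real.log ‖z‖ + b : ℝ))).re
      rw [Complex.add_re, Complex.add_re, Complex.log_re, Complex.ofReal_re, norm_div, norm_mul,
        Complex.norm_exp, Real.log_mul (norm_ne_zero_iff.2 hw0) (Real.exp_ne_zero _), Real.log_exp,
        Real.log_div (norm_ne_zero_iff.2 hw0) (norm_ne_zero_iff.2 hz)]
      ring
    · refine ((((hasDerivAt_id w).div_const z).clog hw).add
        ((hasDerivAt_psiPrim ε w).add_const _)).congr_deriv ?_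
      change 1 / z / (w / z) + (ε - ε ^ 2 * w / 2) = w * (psi ε w / w ^ 2)
      rw [psi]
      field_simp
      ring

/-! ### The surface in its height coordinate -/

/-- The surface reparametrized by its height coordinate, so that the level curves of the height
become the circles `|w| = r`. -/
def levelSurface (ε : ℂ) (b : ℝ) : ℂ → E3 := surface ε b ∘ heightInv ε

namespace IsGoodRadius

variable {ε w : ℂ} {R : ℝ}

lemma eventually_hasDerivAt (hR : IsGoodRadius ε R) (hw : w ∈ ball (0 : ℂ) R) :
    ∀ᶠ v in 𝓝 w, HasDerivAt (heightInv ε) (deriv (heightInv ε) v) v := by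
  filter_upwards [isOpen_ball.mem_nhds hw] with v hv
  exact (hR.analyticAt v hv).differentiableAt.hasDerivAt

lemma isReIntegralAt_levelSurface (hR : IsGoodRadius ε R) (b : ℝ) (hw : w ∈ ball (0 : ℂ) R)
    (hw0 : w ≠ 0) :
    IsReIntegralAt (levelSurface ε b) (fun j v => weierstrassVec
      (heightInv ε v * deriv (heightInv ε) v) (psi ε (heightInv ε v) / heightInv ε v ^ 2) j) w := by
  have h := (isReIntegralAt_surface ε b (hR.heightInv_ne_zero hw hw0)).comp
    (hR.eventually_hasDerivAt hw)
  convert! h using 3 with j v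
  fin_cases j <;> simp [weierstrassVec] <;> ring

lemma levelSurface_two (hR : IsGoodRadius ε R) (b : ℝ) (hw : w ∈ ball (0 : ℂ) R) :
    levelSurface ε b w 2 = Real.log ‖w‖ + b := by
  change Real.log ‖heightCoord ε (heightInv ε w)‖ + b = _
  rw [hR.right_inv w hw]

lemma mul_deriv_ne_zero (hR : IsGoodRadius ε R) (hw : w ∈ ball (0 : ℂ) R) (hw0 : w ≠ 0) :
    heightInv ε w * deriv (heightInv ε) w ≠ 0 :=
  mul_ne_zero (hR.heightInv_ne_zero hw hw0) (hR.deriv_heightInv_ne_zero hw hw0)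

lemma gaussMap_levelSurface (hR : IsGoodRadius ε R) (b : ℝ) (hw : w ∈ ball (0 : ℂ) R)
    (hw0 : w ≠ 0) : gaussMap (levelSurface ε b) w = (w ^ 2 * gaussFactor ε w)⁻¹ := by
  rw [← hR.psi_div_sq hw hw0]
  exact (hR.isReIntegralAt_levelSurface b hw hw0).gaussMap_eq (hR.mul_deriv_ne_zero hw hw0)

lemma phi_two_levelSurface (hR : IsGoodRadius ε R) (b : ℝ) (hw : w ∈ ball (0 : ℂ) R)
    (hw0 : w ≠ 0) : phi (levelSurface ε b) 2 w = w⁻¹ := by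
  have h0 := hR.heightInv_ne_zero hw hw0
  rw [(hR.isReIntegralAt_levelSurface b hw hw0).phi_eq, ← hR.deriv_heightInv hw hw0]
  simp only [weierstrassVec, Matrix.cons_val]
  field_simp

lemma circleMap_mem_ball {r : ℝ} (hr : 0 < r) (hrR : r < R) (θ : ℝ) :
    circleMap 0 r θ ∈ ball (0 : ℂ) R := by
  rw [mem_ball_zero_iff, norm_circleMap_zero, abs_of_pos hr]
  exact hrR

/-- As `f g dw = dw / w`, the length element is `(|g| + |g|⁻¹) / 2 dθ`. -/
lemma norm_tangential_levelSurface (hR : IsGoodRadius ε R) (b : ℝ) {r : ℝ} (hr : 0 < r)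
    (hrR : r < R) (θ : ℝ) :
    ‖tangential (levelSurface ε b) r θ‖
      = 1 / 2 * ((r ^ 2)⁻¹ * ‖(gaussRoot ε (circleMap 0 r θ))⁻¹‖ ^ 2
        + r ^ 2 * ‖gaussRoot ε (circleMap 0 r θ)‖ ^ 2) := by
  have hw := circleMap_mem_ball hr hrR θ
  have hw0 : circleMap 0 r θ ≠ 0 := circleMap_ne_center hr.ne'
  have h0 := hR.heightInv_ne_zero hw hw0
  rw [(hR.isReIntegralAt_levelSurface b hw hw0).norm_tangential hr]
  have hfg := congrArg norm (hR.deriv_heightInv hw hw0)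
  have hg := congrArg norm (hR.psi_div_sq hw hw0)
  have hnr : ‖circleMap 0 r θ‖ = r := by rw [norm_circleMap_zero, abs_of_pos hr]
  rw [norm_inv, norm_mul, norm_pow, ← gaussRoot_sq (hR.psi_heightInv_ne_zero _ hw), norm_pow,
    hnr] at hg
  rw [show psi ε (heightInv ε (circleMap 0 r θ)) / heightInv ε (circleMap 0 r θ)
      = psi ε (heightInv ε (circleMap 0 r θ)) / heightInv ε (circleMap 0 r θ) ^ 2
        * heightInv ε (circleMap 0 r θ) by field_simp, mul_assoc, norm_mul, hg,
    norm_inv, hnr] at hfg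
  rw [hg, norm_inv]
  have hP : 0 < ‖gaussRoot ε (circleMap 0 r θ)‖ := norm_pos_iff.2 (gaussRoot_ne_zero _ _)
  have hf : ‖heightInv ε (circleMap 0 r θ) * deriv (heightInv ε) (circleMap 0 r θ)‖
      = r * ‖gaussRoot ε (circleMap 0 r θ)‖ ^ 2 := by
    field_simp at hfg
    rw [hfg]
  rw [hf]
  field_simp
  ring

end IsGoodRadius

/-- For small radii the level length satisfies `L'' < 4 L`: the coefficient of `w` in the expansion
of `gaussRoot⁻¹` is `3 ε / 2 ≠ 0`. -/
theorem eventually_levelLength {ε : ℂ} (hε : ε ≠ 0) :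
    ∀ᶠ r in 𝓝[>] (0 : ℝ), ∀ b : ℝ,
      ContDiffOn ℝ 2 (levelLength (levelSurface ε b)) (Set.Iio (Real.log r)) ∧
      ∀ t < Real.log r, deriv (deriv (levelLength (levelSurface ε b))) t
        < 4 * levelLength (levelSurface ε b) t := by
  obtain ⟨R, hR0, hR⟩ := exists_isGoodRadius ε
  have hP := analyticAt_gaussRoot ε
  have hP0 : gaussRoot ε 0 = 1 := by simp [gaussRoot]
  obtain ⟨A, hA, hA', hAr⟩ := exists_analyticAt_integral_norm_sq (hP.inv (gaussRoot_ne_zero ε 0))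
  obtain ⟨B, hB, -, hBr⟩ := exists_analyticAt_integral_norm_sq hP
  have hA'pos : 0 < deriv A 0 := by
    have h1 : deriv (gaussRoot ε)⁻¹ 0 = 3 / 2 * ε := by
      rw [((hasDerivAt_gaussRoot_zero ε).inv (gaussRoot_ne_zero ε 0)).deriv, hP0]
      ring
    rw [hA', h1]
    exact pow_pos (norm_pos_iff.2 (mul_ne_zero (by norm_num) hε)) 2
  have hPc : ∀ᶠ w in 𝓝 (0 : ℂ), ContinuousAt (gaussRoot ε) w :=
    hP.eventually_analyticAt.mono fun w hw => hw.continuousAt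
  obtain ⟨τ, hτ, hτball⟩ := Metric.eventually_nhds_iff_ball.1 (hAr.and hBr)
  obtain ⟨σ, hσ, hσball⟩ := Metric.eventually_nhds_iff_ball.1 hPc
  filter_upwards [exists_deriv_deriv_lt_four_mul hA hB hA'pos π Real.pi_pos,
    Ioo_mem_nhdsGT (lt_min hR0 (lt_min hτ hσ))] with r hr hrs b
  refine hr _ fun t ht => ?_
  have hs0 := Real.exp_pos t
  have hsr : Real.exp t < r := (Real.lt_log_iff_exp_lt hrs.1).1 ht
  have hsR : Real.exp t < R := hsr.trans (hrs.2.trans_le (min_le_left _ _))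
  have hsτ : Real.exp t < τ :=
    hsr.trans (hrs.2.trans_le ((min_le_right _ _).trans (min_le_left _ _)))
  have hsσ : Real.exp t < σ :=
    hsr.trans (hrs.2.trans_le ((min_le_right _ _).trans (min_le_right _ _)))
  obtain ⟨hA2, hB2⟩ := hτball (Real.exp t) (by
    rwa [mem_ball_zero_iff, Real.norm_of_nonneg hs0.le])
  have hcont : Continuous fun θ => gaussRoot ε (circleMap 0 (Real.exp t) θ) :=
    continuous_iff_continuousAt.2 fun θ =>
      (hσball _ (IsGoodRadius.circleMap_mem_ball hs0 hsσ θ)).comp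
        (continuous_circleMap 0 (Real.exp t)).continuousAt
  have hcont' : Continuous fun θ => (gaussRoot ε (circleMap 0 (Real.exp t) θ))⁻¹ :=
    hcont.inv₀ fun θ => gaussRoot_ne_zero _ _
  have hexp : Real.exp (2 * t) = Real.exp t ^ 2 := by
    rw [← Real.exp_nat_mul]; norm_num
  simp only [levelLength, hR.norm_tangential_levelSurface b hs0 hsR, Real.exp_neg, hexp]
  rw [intervalIntegral.integral_const_mul, intervalIntegral.integral_add
      (Continuous.intervalIntegrable (by fun_prop) _ _)
      (Continuous.intervalIntegrable (by fun_prop) _ _),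
    intervalIntegral.integral_const_mul, intervalIntegral.integral_const_mul, hB2]
  simp only [Pi.inv_apply] at hA2
  rw [hA2]
  ring

/-! ### Geometry of the pieces inside a slab -/

namespace IsGoodRadius

variable {ε : ℂ} {R R₀ R₁ h b : ℝ}

lemma closedAnnulus_subset_ball (hR : R₁ < R) : closedAnnulus R₀ R₁ ⊆ ball 0 R :=
  fun w hw => by simpa using hw.2.trans_lt hR

lemma ne_zero_of_mem_closedAnnulus (hR₀ : 0 < R₀) {w : ℂ} (hw : w ∈ closedAnnulus R₀ R₁) : w ≠ 0 :=
  norm_pos_iff.1 (hR₀.trans_le hw.1)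

theorem isMinimalAnnulus (hg : IsGoodRadius ε R) (hR₀ : 0 < R₀) (hR₀₁ : R₀ < R₁) (hR : R₁ < R)
    (hlog₀ : Real.log R₀ + b = -h) (hlog₁ : Real.log R₁ + b = h) :
    IsMinimalAnnulus h R₀ R₁ (levelSurface ε b) := by
  have hre : ∀ w ∈ closedAnnulus R₀ R₁, _ := fun w hw =>
    hg.isReIntegralAt_levelSurface b (closedAnnulus_subset_ball hR hw)
      (ne_zero_of_mem_closedAnnulus hR₀ hw)
  have hsub := annulus_subset_closedAnnulus R₀ R₁
  exact isMinimalAnnulus_of_height hR₀ hR₀₁ hlog₀ hlog₁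
    (fun w hw => (hre w hw).differentiableAt.continuousAt.continuousWithinAt)
    (fun w hw => hg.levelSurface_two b (closedAnnulus_subset_ball hR hw))
    (fun w hw => (hre w (hsub hw)).harmonicAt)
    (fun w hw => (hre w (hsub hw)).conformalAt (hg.mul_deriv_ne_zero
      (closedAnnulus_subset_ball hR (hsub hw)) (ne_zero_of_mem_closedAnnulus hR₀ (hsub hw))))

theorem hasWindingNumber (hg : IsGoodRadius ε R) (hR₀ : 0 < R₀) (hR : R₁ < R) :
    HasWindingNumber R₀ R₁ (levelSurface ε b) (-2) := by
  have hsub := annulus_subset_closedAnnulus R₀ R₁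
  have hball : ∀ w ∈ annulus R₀ R₁, w ∈ ball (0 : ℂ) R := fun w hw =>
    closedAnnulus_subset_ball hR (hsub hw)
  have hne : ∀ w ∈ annulus R₀ R₁, w ≠ 0 := fun w hw =>
    ne_zero_of_mem_closedAnnulus hR₀ (hsub hw)
  refine ⟨fun w hw => ⟨?_, ?_⟩, fun r hr => ?_⟩
  · rw [hg.phi_two_levelSurface b (hball w hw) (hne w hw)]
    exact inv_ne_zero (hne w hw)
  · rw [(hg.isReIntegralAt_levelSurface b (hball w hw) (hne w hw)).phi_sub_eq]
    exact hg.mul_deriv_ne_zero (hball w hw) (hne w hw)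
  have hr0 : 0 < r := hR₀.trans hr.1
  have hrR : r < R := hr.2.trans hR
  have hQ : DifferentiableOn ℂ (fun w => deriv (gaussFactor ε) w / gaussFactor ε w) (ball 0 R) :=
    (hg.differentiableOn_gaussFactor.deriv isOpen_ball).div hg.differentiableOn_gaussFactor
      fun w hw => hg.gaussFactor_ne_zero hw
  have hcb : closedBall (0 : ℂ) r ⊆ ball 0 R := closedBall_subset_ball hrR
  have hEq : Set.EqOn (fun w => deriv (gaussMap (levelSurface ε b)) w
      / gaussMap (levelSurface ε b) w)
      (fun w => -2 * (w - 0)⁻¹ - deriv (gaussFactor ε) w / gaussFactor ε w) (sphere 0 r) := by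
    intro w hw
    have hwr : ‖w‖ = r := by simpa using hw
    have hwA : w ∈ annulus R₀ R₁ := ⟨by rw [hwr]; exact hr.1, by rw [hwr]; exact hr.2⟩
    have hev : gaussMap (levelSurface ε b) =ᶠ[𝓝 w] fun w => (w ^ 2 * gaussFactor ε w)⁻¹ := by
      filter_upwards [(isOpen_annulus R₀ R₁).mem_nhds hwA] with v hv
      exact hg.gaussMap_levelSurface b (hball v hv) (hne v hv)
    have hw0 := hne w hwA
    have hQ0 := hg.gaussFactor_ne_zero (hball w hwA)
    have hd := ((hasDerivAt_pow 2 w).mul (hg.differentiableOn_gaussFactor.differentiableAt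
      (isOpen_ball.mem_nhds (hball w hwA))).hasDerivAt).inv (mul_ne_zero (pow_ne_zero 2 hw0) hQ0)
    simp only
    rw [hev.deriv_eq, hev.self_of_nhds]
    refine (congrArg (· / _) hd.deriv).trans ?_
    simp
    field_simp
    ring
  rw [circleIntegral.integral_congr hr0.le hEq, circleIntegral.integral_sub,
    circleIntegral.integral_const_mul, circleIntegral.integral_sub_center_inv _ hr0.ne',
    Complex.circleIntegral_eq_zero_of_differentiable_on_off_countable hr0.le Set.countable_empty
      (hQ.continuousOn.mono hcb)
      (fun w hw => hQ.differentiableAt (isOpen_ball.mem_nhds (hcb (ball_subset_closedBall hw.1))))]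
  · push_cast
    ring
  · refine ContinuousOn.circleIntegrable hr0.le (continuousOn_const.mul
      ((continuousOn_id.sub continuousOn_const).inv₀ fun w hw => ?_))
    have hwr : ‖w‖ = r := by simpa using hw
    simpa using norm_pos_iff.1 (hwr ▸ hr0)
  · exact (hQ.continuousOn.mono (sphere_subset_closedBall.trans hcb)).circleIntegrable hr0.le

theorem flux_eq_zero (hg : IsGoodRadius ε R) {r : ℝ} (hr : 0 < r) (hrR : r < R) :
    flux (levelSurface ε b) r 0 = 0 ∧ flux (levelSurface ε b) r 1 = 0 := by
  have hball := IsGoodRadius.circleMap_mem_ball hr hrR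
  have hne : ∀ θ, circleMap 0 r θ ≠ 0 := fun θ => circleMap_ne_center hr.ne'
  have hT : Continuous fun θ => heightInv ε (circleMap 0 r θ) :=
    continuous_iff_continuousAt.2 fun θ => (hg.analyticAt _ (hball θ)).continuousAt.comp
      (continuous_circleMap 0 r).continuousAt
  have hT' : Continuous fun θ => deriv (heightInv ε) (circleMap 0 r θ) :=
    continuous_iff_continuousAt.2 fun θ => (hg.analyticAt _ (hball θ)).deriv.continuousAt.comp
      (continuous_circleMap 0 r).continuousAt
  have hg' : Continuous fun θ => psi ε (heightInv ε (circleMap 0 r θ))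
      / heightInv ε (circleMap 0 r θ) ^ 2 := by
    refine Continuous.div ?_ (hT.pow 2)
      fun θ => pow_ne_zero 2 (hg.heightInv_ne_zero (hball θ) (hne θ))
    unfold psi
    fun_prop
  have hfc := hT.fun_mul hT'
  have hflux := flux_apply hr (fun θ => hg.isReIntegralAt_levelSurface b (hball θ) (hne θ))
    (fun θ => hg.mul_deriv_ne_zero (hball θ) (hne θ)) hfc hg'
  have hac := continuous_weierstrassVec hfc hg'
  have hmem : ∀ w : ℂ, ‖w‖ = r → w ∈ ball (0 : ℂ) R ∧ w ≠ 0 := fun w hw =>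
    ⟨by simpa [hw] using hrR, norm_pos_iff.1 (hw ▸ hr)⟩
  refine ⟨?_, ?_⟩
  · rw [hflux]
    refine integral_re_mul_circleMap_eq_zero (Φ := fun w => prim₁ ε (heightInv ε w))
      (a := fun v => weierstrassVec (heightInv ε v * deriv (heightInv ε) v)
        (psi ε (heightInv ε v) / heightInv ε v ^ 2) 0) hr.le (fun w hw => ?_) (hac 0)
    obtain ⟨hwb, hw0⟩ := hmem w hw
    refine ((hasDerivAt_prim₁ ε (hg.heightInv_ne_zero hwb hw0)).comp w
      (hg.analyticAt w hwb).differentiableAt.hasDerivAt).congr_deriv ?_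
    simp only [weierstrassVec, Matrix.cons_val]
    ring
  · rw [hflux]
    refine integral_re_mul_circleMap_eq_zero (Φ := fun w => prim₂ ε (heightInv ε w))
      (a := fun v => weierstrassVec (heightInv ε v * deriv (heightInv ε) v)
        (psi ε (heightInv ε v) / heightInv ε v ^ 2) 1) hr.le (fun w hw => ?_) (hac 1)
    obtain ⟨hwb, hw0⟩ := hmem w hw
    refine ((hasDerivAt_prim₂ ε (hg.heightInv_ne_zero hwb hw0)).comp w
      (hg.analyticAt w hwb).differentiableAt.hasDerivAt).congr_deriv ?_
    simp only [weierstrassVec, Matrix.cons_val]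
    ring

/-- A map factoring through `w ↦ w ^ 2` has an even Gauss map, but the coefficient of `w` in
`gaussFactor` is `-3 ε`. -/
theorem not_memAStar (hg : IsGoodRadius ε R) (hε : ε ≠ 0) (hR₀ : 0 < R₀) (hR₀₁ : R₀ < R₁)
    (hR : R₁ < R) : ¬ MemAStar h R₀ R₁ 2 (levelSurface ε b) := by
  rintro ⟨-, G, -, hG⟩
  have hsub := annulus_subset_closedAnnulus R₀ R₁
  have hball : ∀ w ∈ annulus R₀ R₁, w ∈ ball (0 : ℂ) R := fun w hw =>
    closedAnnulus_subset_ball hR (hsub hw)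
  have hne : ∀ w ∈ annulus R₀ R₁, w ≠ 0 := fun w hw =>
    ne_zero_of_mem_closedAnnulus hR₀ (hsub hw)
  have hneg : ∀ w ∈ annulus R₀ R₁, -w ∈ annulus R₀ R₁ := fun w hw => by
    simpa [annulus] using hw
  have hphi : ∀ w ∈ annulus R₀ R₁, ∀ j,
      phi (levelSurface ε b) j w = -phi (levelSurface ε b) j (-w) := by
    intro w hw j
    have h1 := (hg.isReIntegralAt_levelSurface b (hball _ (hneg w hw)) (hne _ (hneg w hw)))
    have h2 := h1.comp (T := fun v => -v) (T' := fun _ => -1)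
      (Eventually.of_forall fun v => hasDerivAt_neg v)
    have h3 : levelSurface ε b =ᶠ[𝓝 w] levelSurface ε b ∘ fun v => -v := by
      filter_upwards [(isOpen_annulus R₀ R₁).mem_nhds hw] with v hv
      rw [hG hv, Function.comp_apply, hG (hneg v hv)]
      simp
    rw [h1.phi_eq, phi, h3.fderiv_eq, ← phi, h2.phi_eq]
    simp
  have heven : ∀ w ∈ annulus R₀ R₁, gaussFactor ε w = gaussFactor ε (-w) := by
    intro w hw
    have h1 : gaussMap (levelSurface ε b) w = gaussMap (levelSurface ε b) (-w) := by
      rw [gaussMap, hphi w hw, hphi w hw, hphi w hw, gaussMap, mul_neg, ← neg_sub', neg_div_neg_eq]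
    rw [hg.gaussMap_levelSurface b (hball w hw) (hne w hw),
      hg.gaussMap_levelSurface b (hball _ (hneg w hw)) (hne _ (hneg w hw)), neg_sq] at h1
    exact mul_left_cancel₀ (pow_ne_zero 2 (hne w hw)) (inv_injective h1)
  have hQ := hg.differentiableOn_gaussFactor
  have hQneg : DifferentiableOn ℂ (fun w => gaussFactor ε (-w)) (ball 0 R) :=
    hQ.comp differentiable_neg.differentiableOn fun w hw => by simpa using hw
  have hRpos : 0 < R := hR₀.trans (hR₀₁.trans hR)
  have hmid : (((R₀ + R₁) / 2 : ℝ) : ℂ) ∈ annulus R₀ R₁ := by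
    have : ‖(((R₀ + R₁) / 2 : ℝ) : ℂ)‖ = (R₀ + R₁) / 2 := by
      rw [Complex.norm_real, Real.norm_of_nonneg (by linarith)]
    exact ⟨by rw [this]; linarith, by rw [this]; linarith⟩
  have hEq := (hQ.analyticOnNhd isOpen_ball).eqOn_of_preconnected_of_eventuallyEq
    (hQneg.analyticOnNhd isOpen_ball) (convex_ball (0 : ℂ) R).isPreconnected (hball _ hmid)
    (Filter.eventuallyEq_of_mem ((isOpen_annulus R₀ R₁).mem_nhds hmid) heven)
  have hev : gaussFactor ε =ᶠ[𝓝 0] fun w => gaussFactor ε (-w) :=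
    hEq.eventuallyEq_of_mem (ball_mem_nhds 0 hRpos)
  have hd := hasDerivAt_gaussFactor_zero ε
  have hd' : HasDerivAt (fun w => gaussFactor ε (-w)) (-3 * ε * -1) 0 :=
    HasDerivAt.comp (h₂ := gaussFactor ε) 0 (by simpa using hd) (hasDerivAt_neg 0)
  have h6 : ε * 6 = 0 := by linear_combination (hd'.congr_of_eventuallyEq hev).unique hd
  exact hε ((mul_eq_zero.1 h6).resolve_right (by norm_num))

theorem isSlabPiece (hg : IsGoodRadius ε (4 * R₁)) (hR₀ : 0 < R₀) (hR₀₁ : R₀ < R₁)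
    (hlog₀ : Real.log R₀ + b = -h) (hlog₁ : Real.log R₁ + b = h) {f g : ℂ → ℂ}
    (hf : ∀ z ≠ 0, f z = z) (hgauss : ∀ z ≠ 0, g z = psi ε z / z ^ 2) :
    IsSlabPiece h R₀ R₁ (levelSurface ε b) f g := by
  have hR₁ : 0 < R₁ := hR₀.trans hR₀₁
  have hne : ∀ z ∈ annulus (R₀ / 4) (4 * R₁), z ≠ 0 := fun z hz =>
    norm_pos_iff.1 (lt_trans (by positivity) hz.1)
  have hball : ∀ w ∈ annulus R₀ R₁, w ∈ ball (0 : ℂ) (4 * R₁) := fun w hw => by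
    have := hw.2
    rw [mem_ball_zero_iff]
    linarith
  have hsub : heightInv ε '' annulus R₀ R₁ ⊆ closedAnnulus (R₀ / 2) (2 * R₁) := by
    rintro _ ⟨w, hw, rfl⟩
    have h1 := hg.norm_le w (hball w hw)
    have h2 := hg.le_norm w (hball w hw)
    exact ⟨by linarith [hw.1], by linarith [hw.2]⟩
  have hsub' : closedAnnulus (R₀ / 2) (2 * R₁) ⊆ annulus (R₀ / 4) (4 * R₁) := fun z hz =>
    ⟨by linarith [hz.1], by linarith [hz.2]⟩
  refine ⟨R₀ / 4, 4 * R₁, surface ε b, heightInv ε, by positivity, by linarith, ?_, ?_, ?_, ?_, ?_,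
    ?_, ?_, ?_, fun _ _ => rfl⟩
  · exact differentiableOn_id.congr fun z hz => hf z (hne z hz)
  · refine DifferentiableOn.congr (f := fun z => psi ε z / z ^ 2) (fun z hz => ?_)
      fun z hz => hgauss z (hne z hz)
    exact ((hasDerivAt_psi ε z).differentiableAt.div (differentiableAt_id.pow 2)
      (pow_ne_zero 2 (hne z hz))).differentiableWithinAt
  · intro z hz
    rw [hf z (hne z hz), hgauss z (hne z hz)]
    exact ⟨hne z hz, div_ne_zero (hg.psi_ne_zero z (by simpa using hz.2))
      (pow_ne_zero 2 (hne z hz))⟩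
  · intro z hz
    have hX := isReIntegralAt_surface ε b (hne z hz)
    rw [hf z (hne z hz), hgauss z (hne z hz)]
    exact ⟨hX.differentiableAt, hX.phi_eq 0, hX.phi_eq 1, hX.phi_eq 2⟩
  · exact fun w hw => (hg.analyticAt w (hball w hw)).differentiableAt.differentiableWithinAt
  · intro v hv w hw hvw
    rw [← hg.right_inv v (hball v hv), ← hg.right_inv w (hball w hw), hvw]
  · refine Set.Subset.antisymm (fun z hz => ⟨hsub' (hsub hz), ?_⟩) fun z hz => ?_
    · obtain ⟨w, hw, rfl⟩ := hz
      have h1 := hg.levelSurface_two b (hball w hw)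
      have h2 := Real.log_lt_log hR₀ hw.1
      have h3 := Real.log_lt_log (hR₀.trans hw.1) hw.2
      change -h < levelSurface ε b w 2 ∧ levelSurface ε b w 2 < h
      rw [h1]
      exact ⟨by linarith, by linarith⟩
    · obtain ⟨hzA, h1, h2⟩ := hz
      change -h < Real.log ‖heightCoord ε z‖ + b at h1
      change Real.log ‖heightCoord ε z‖ + b < h at h2
      have h0 : 0 < ‖heightCoord ε z‖ :=
        norm_pos_iff.2 (mul_ne_zero (hne z hzA) (Complex.exp_ne_zero _))
      refine ⟨heightCoord ε z, ⟨?_, ?_⟩, hg.left_inv z (by simpa using hzA.2)⟩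
      · exact (Real.log_lt_log_iff hR₀ h0).1 (by linarith)
      · exact (Real.log_lt_log_iff h0 hR₁).1 (by linarith)
  · exact (closure_minimal hsub (isClosed_closedAnnulus _ _)).trans hsub'

end IsGoodRadius

end

end MinimalAnnuli

theorem mainTheorem3 :
    ∃ c₁ c₂ : ℂ, c₁ ≠ 0 ∧ c₂ ≠ 0 ∧
      ∀ h : ℝ, 0 < h → ∀ η : ℝ, 0 < η →
        ∃ ε₁ δ₁ ε₂ δ₂ : ℂ,
          ‖ε₁‖ < η ∧ ‖δ₁‖ < η ∧ ‖ε₂‖ < η ∧ ‖δ₂‖ < η ∧ (ε₁ ≠ 0 ∨ ε₂ ≠ 0) ∧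
          ε₁ ^ 2 + 2 * δ₁ * c₁ = 0 ∧ ε₂ ^ 2 + 2 * δ₂ * c₂ = 0 ∧
          ∃ (R₀ R₁ : ℝ) (F : ℂ → MinimalAnnuli.E3),
            MinimalAnnuli.MemAV h R₀ R₁ 2 F ∧
            ¬ MinimalAnnuli.MemAStar h R₀ R₁ 2 F ∧
            ContDiffOn ℝ 2 (MinimalAnnuli.levelLength F)
              (Set.Ioo (Real.log R₀) (Real.log R₁)) ∧
            (∀ t ∈ Set.Ioo (Real.log R₀) (Real.log R₁),
              deriv (deriv (MinimalAnnuli.levelLength F)) t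
                < 4 * MinimalAnnuli.levelLength F t) ∧
            MinimalAnnuli.IsSlabPiece h R₀ R₁ F
              (fun z => (c₁ * z + ε₁ + δ₁ * z⁻¹) ^ 2 / z)
              (fun z => (c₂ * z⁻¹ + ε₂ + δ₂ * z) / (c₁ * z + ε₁ + δ₁ * z⁻¹)) := by
  refine ⟨1, 1, one_ne_zero, one_ne_zero, fun h hh η hη => ?_⟩
  -- `e < 1` gives `e ^ 2 / 2 < e`, so `e < η` bounds both parameters.
  obtain ⟨e, he0, he1⟩ := exists_between (lt_min hη one_pos)
  have heη : e < η := he1.trans_le (min_le_left _ _)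
  have hε : (e : ℂ) ≠ 0 := by exact_mod_cast he0.ne'
  have hne : ‖(e : ℂ)‖ = e := by rw [Complex.norm_real, Real.norm_of_nonneg he0.le]
  obtain ⟨R, hR0, hR⟩ := MinimalAnnuli.exists_isGoodRadius (e : ℂ)
  obtain ⟨R₁, hlen, hR₁⟩ := ((MinimalAnnuli.eventually_levelLength hε).and
    (Ioo_mem_nhdsGT (show (0 : ℝ) < R / 4 by positivity))).exists
  have hR₁0 : 0 < R₁ := hR₁.1
  have hg : MinimalAnnuli.IsGoodRadius (e : ℂ) (4 * R₁) := hR.mono (by linarith [hR₁.2])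
  -- The height on `|w| = r` is `log r + b`: translating the surface up by `b` places a piece with
  -- small outer radius `R₁` in the slab, whatever `h` is.
  set b : ℝ := h - Real.log R₁ with hb
  set R₀ : ℝ := Real.exp (-(2 * h)) * R₁ with hR₀def
  have hR₀ : 0 < R₀ := by positivity
  have hR₀₁ : R₀ < R₁ := mul_lt_of_lt_one_left hR₁0 (Real.exp_lt_one_iff.2 (by linarith))
  have hlog₁ : Real.log R₁ + b = h := by rw [hb]; ring
  have hlog₀ : Real.log R₀ + b = -h := by
    rw [hR₀def, Real.log_mul (Real.exp_ne_zero _) hR₁0.ne', Real.log_exp, hb]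
    ring
  have hlt : R₁ < 4 * R₁ := by linarith
  have hIoo : Set.Ioo (Real.log R₀) (Real.log R₁) ⊆ Set.Iio (Real.log R₁) := fun t ht => ht.2
  refine ⟨0, 0, e, -(e : ℂ) ^ 2 / 2, by simpa, by simpa, by rwa [hne], ?_, Or.inr hε, by simp,
    by ring, R₀, R₁, MinimalAnnuli.levelSurface e b,
    ⟨⟨hg.isMinimalAnnulus hR₀ hR₀₁ hlt hlog₀ hlog₁, Or.inr (hg.hasWindingNumber hR₀ hlt)⟩,
      fun r hr => hg.flux_eq_zero (hR₀.trans hr.1) (hr.2.trans hlt)⟩,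
    hg.not_memAStar hε hR₀ hR₀₁ hlt, (hlen b).1.mono hIoo, fun t ht => (hlen b).2 t ht.2,
    hg.isSlabPiece hR₀ hR₀₁ hlog₀ hlog₁ (fun z hz => ?_) fun z hz => ?_⟩
  · rw [norm_div, norm_neg, norm_pow, hne, Complex.norm_two]
    have : e < 1 := he1.trans_le (min_le_right _ _)
    nlinarith
  · field_simp
    ring
  · rw [MinimalAnnuli.psi]
    field_simp
    ring
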